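/- \textbf{Theorem (strong consistency, continuous observations).} Let $B=\{B_t,\ t\ge 0\}$ be a centered Gaussian process with stationary increments and $B_0=0$, let $\theta\in\mathbb R$, and let $X_t=\theta t+B_t$. Assume: 1. The covariance function $R(t,s)=\mathsf E B_tB_s$ has a mixed derivative $\frac{\partial^2}{\partial s\,\partial t}R(t,s)=K(t-s)$, where $K$ is an even function with $K\in L_1[-T,T]$ for every $T>0$. (That is, $\partial R/\partial t$ exists for all $t,s\ge0$, one-sided at $t=0$, and for each $t$ it is locally absolutely continuous in $s\ge 0$ with derivative $K(t-s)$ for almost every $s$.) 2. For every $T>0$ there is a function $h_T\in L_2[0,T]$ with $\Gamma_Th_T=1$ almost everywhere on $[0,T]$, where $\Gamma_Tf(t)=\int_0^TK(t-s)f(s)\,ds$. 3. $\mathsf E (B_{N+1}-B_N)B_1\to0$ as $N\to\infty$, $N\in\mathbb N$. For any such choice of the functions $h_T$, consider for $T>0$ \[ \hat\theta_T=\frac{\int_0^Th_T(t)\,dX_t}{\int_0^Th_T(t)\,dt}, \] where $\int_0^T f(t)\,dX_t$, $f\in L_2[0,T]$, is the mean-square limit of the integrals of step functions that tend to $f$ in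 $L_2[0,T]$. These integrals exist for $f=h_T$, and, for every $T>0$, $\hat\theta_T$ is the maximum likelihood estimator of $\theta$ by the observation of $X$ on $[0,T]$: it is almost surely the unique maximizer over $\vartheta\in\mathbb R$, at the observed path, of the likelihood, i.e. of the density (which exists and is chosen continuous in $\vartheta$) of the law of $(\vartheta t+B_t)_{0\le t\le T}$ with respect to the law of $(B_t)_{0\le t\le T}$. Then $\hat\theta_T$ is strongly consistent: $\hat\theta_T\to\theta$ almost surely as $T\to\infty$. Precisely, since each $\hat\theta_T$ is defined only up to a null event: the process $\{\hat\theta_T,\ T>0\}$ has a real-valued separable version (in the sense of Doob); for every separable version, almost surely $\hat\theta_T\to\theta$ as $T\to\infty$; and for every version and every countable set $D\subset[0,\infty)$, almost surely $\hat\theta_T\to\theta$ as $T\to\infty$ along $D$. -/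

import Mathlib

open MeasureTheory ProbabilityTheory Filter Topology Set
open scoped NNReal ENNReal

noncomputable section

namespace DriftMLE

variable {Ω : Type*} [MeasurableSpace Ω]

/-- `B = (B_t)_{t ≥ 0}` is a centered Gaussian process with stationary increments and `B_0 = 0`. -/
structure IsGaussianNoise (P : Measure Ω) (B : ℝ≥0 → Ω → ℝ) : Prop where
  measurable : ∀ t, Measurable (B t)
  gaussian : IsGaussianProcess B P
  centered : ∀ t, ∫ ω, B t ω ∂P = 0
  zero : ∀ᵐ ω ∂P, B 0 ω = 0
  /-- For every `s`, the processes `(B_{s+t} - B_s)_{t ≥ 0}` and `(B_t - B_0)_{t ≥ 0}` have the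
  same law. -/
  stationary : ∀ s : ℝ≥0,
    P.map (fun ω (t : ℝ≥0) => B (s + t) ω - B s ω) = P.map (fun ω (t : ℝ≥0) => B t ω - B 0 ω)

/-- The covariance function `E[B_t B_s]`, as a function of real arguments `t, s ≥ 0`. -/
def covFun (P : Measure Ω) (B : ℝ≥0 → Ω → ℝ) (t s : ℝ) : ℝ :=
  ∫ ω, B t.toNNReal ω * B s.toNNReal ω ∂P

/-- The function `R` on `[0,∞)²` has the mixed derivative `∂²R/∂s∂t = k`: the partial derivative
`D = ∂R/∂t` exists everywhere (one-sided at `t = 0`), and for each `t` the function `s ↦ D t s` is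
locally absolutely continuous on `[0,∞)` with derivative `k t s` for almost every `s`. -/
def HasMixedDeriv (R k : ℝ → ℝ → ℝ) : Prop :=
  ∃ D : ℝ → ℝ → ℝ,
    (∀ t s : ℝ, 0 ≤ t → 0 ≤ s → HasDerivWithinAt (fun τ => R τ s) (D t s) (Ici 0) t) ∧
    ∀ t : ℝ, 0 ≤ t →
      (∀ S : ℝ, 0 < S → AbsolutelyContinuousOnInterval (D t) 0 S) ∧
      ∀ᵐ s ∂(volume.restrict (Ioi (0 : ℝ))), HasDerivAt (D t) (k t s) s

/-- The covariance function of `B` has the mixed derivative `K (t - s)`, where `K` is even and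
integrable on `[-T, T]` for every `T > 0`. -/
structure HasCovKernel (P : Measure Ω) (B : ℝ≥0 → Ω → ℝ) (K : ℝ → ℝ) : Prop where
  even : ∀ t, K (-t) = K t
  integrable : ∀ T : ℝ, 0 < T → IntegrableOn K (Icc (-T) T)
  mixedDeriv : HasMixedDeriv (covFun P B) (fun t s => K (t - s))

/-- The operator `(Γ_T f)(t) = ∫_0^T K(t-s) f(s) ds`. -/
def covOp (K : ℝ → ℝ) (T : ℝ≥0) (f : ℝ → ℝ) (t : ℝ) : ℝ :=
  ∫ s in (0 : ℝ)..T, K (t - s) * f s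

/-- `f ∈ L²[0,T]` and `Γ_T f = 1` in `L²[0,T]`. -/
def SolvesOne (K : ℝ → ℝ) (T : ℝ≥0) (f : ℝ → ℝ) : Prop :=
  MemLp f 2 (volume.restrict (Icc (0 : ℝ) T)) ∧
    ∀ᵐ t ∂(volume.restrict (Icc (0 : ℝ) T)), covOp K T f t = 1

/-- A step function `∑ i, c_i 1_{(a_i, b_i]}` with all `(a_i, b_i] ⊆ [0,T]`. -/
structure Step (T : ℝ≥0) where
  n : ℕ
  left : Fin n → ℝ≥0
  right : Fin n → ℝ≥0
  coeff : Fin n → ℝ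
  left_le_right : ∀ i, left i ≤ right i
  right_le : ∀ i, right i ≤ T

/-- The values of a step function. -/
def Step.toFun {T : ℝ≥0} (g : Step T) (u : ℝ) : ℝ :=
  ∑ i, g.coeff i * (Ioc (g.left i : ℝ) (g.right i : ℝ)).indicator (fun _ => (1 : ℝ)) u

/-- The elementary integral `∑ i, c_i (X_{b_i} - X_{a_i})` of a step function against `X`. -/
def Step.integral {T : ℝ≥0} (g : Step T) (X : ℝ≥0 → Ω → ℝ) (ω : Ω) : ℝ :=
  ∑ i, g.coeff i * (X (g.right i) ω - X (g.left i) ω)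

/-- `I` is (a version of) the stochastic integral `∫_0^T f(t) dX_t`: it is the mean square limit of
the elementary integrals, along every sequence of step functions tending to `f` in `L²[0,T]`. -/
def IsStochIntegral (P : Measure Ω) (X : ℝ≥0 → Ω → ℝ) (T : ℝ≥0) (f : ℝ → ℝ) (I : Ω → ℝ) : Prop :=
  MemLp I 2 P ∧
    ∀ g : ℕ → Step T,
      Tendsto (fun n => eLpNorm (fun u => (g n).toFun u - f u) 2
        (volume.restrict (Icc (0 : ℝ) T))) atTop (𝓝 0) →
      Tendsto (fun n => eLpNorm (fun ω => (g n).integral X ω - I ω) 2 P) atTop (𝓝 0)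

/-- The observed process `X_t = θ t + B_t`. -/
def observed (θ : ℝ) (B : ℝ≥0 → Ω → ℝ) (t : ℝ≥0) (ω : Ω) : ℝ := θ * t + B t ω

/-- The path of a process on `[0,T]`. -/
def pathOn (X : ℝ≥0 → Ω → ℝ) (T : ℝ≥0) (ω : Ω) : Iic T → ℝ := fun t => X t ω

/-- A likelihood function for the observation of `X` on `[0,T]`: `L ϑ` is a density of the law of
`(ϑ t + B_t)_{t ≤ T}` with respect to the law of `(B_t)_{t ≤ T}` on the path space `ℝ^{[0,T]}`, and
the densities are chosen to depend continuously on the parameter `ϑ`. -/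
structure IsLikelihood (P : Measure Ω) (B : ℝ≥0 → Ω → ℝ) (T : ℝ≥0)
    (L : ℝ → (Iic T → ℝ) → ℝ) : Prop where
  measurable : ∀ ϑ, Measurable (L ϑ)
  nonneg : ∀ ϑ x, 0 ≤ L ϑ x
  continuous : ∀ x, Continuous (fun ϑ => L ϑ x)
  density : ∀ ϑ, P.map (pathOn (observed ϑ B) T) =
    (P.map (pathOn (observed 0 B) T)).withDensity (fun x => ENNReal.ofReal (L ϑ x))

/-- `est` is the maximum likelihood estimator by the observation of `X_t = θ t + B_t`, `t ∈ [0,T]`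
(`θ` is the true parameter): a likelihood function exists, and for each of them `est` is almost
surely its unique maximizer at the observed path. -/
def IsMLE (P : Measure Ω) (B : ℝ≥0 → Ω → ℝ) (θ : ℝ) (T : ℝ≥0) (est : Ω → ℝ) : Prop :=
  (∃ L, IsLikelihood P B T L) ∧
    ∀ L, IsLikelihood P B T L →
      ∀ᵐ ω ∂P, ∀ ϑ : ℝ, ϑ ≠ est ω →
        L ϑ (pathOn (observed θ B) T ω) < L (est ω) (pathOn (observed θ B) T ω)

/-- `θhat = (θhat_T)_{T > 0}` is a version of the estimator process
`θhat_T = ∫_0^T h_T(t) dX_t / ∫_0^T h_T(t) dt`: for each `T > 0` this holds almost surely. -/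
def IsEstimatorProcess (P : Measure Ω) (X : ℝ≥0 → Ω → ℝ) (h : ℝ≥0 → ℝ → ℝ)
    (θhat : ℝ≥0 → Ω → ℝ) : Prop :=
  ∀ T : ℝ≥0, 0 < T → ∃ I : Ω → ℝ, IsStochIntegral P X T (h T) I ∧
    ∀ᵐ ω ∂P, θhat T ω = I ω / ∫ t in (0 : ℝ)..T, h T t

/-- Separability in the sense of Doob of the process `(Y_t)_{t > 0}`: there is a countable set `S`
of times such that almost surely every point `(t, Y_t)` of the graph is a limit of points
`(s, Y_s)` with `s ∈ S`. -/
def IsSeparableProcess (P : Measure Ω) (Y : ℝ≥0 → Ω → ℝ) : Prop :=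
  ∃ S : Set ℝ≥0, S ⊆ Ioi 0 ∧ S.Countable ∧
    ∀ᵐ ω ∂P, ∀ t : ℝ≥0, 0 < t → (t, Y t ω) ∈ closure ((fun s => (s, Y s ω)) '' S)

end DriftMLE

end

/-!
The estimation error is a Gaussian martingale run backwards in time. The covariance function of `B`
is `R(t, s) = ∫_0^t ∫_0^s K(τ - u) du dτ` (`HasMixedDeriv.eq_integral`), so that the elementary
integrals of step functions satisfy `E (∫ g dB)² = ∫ g (Γ_T g)`. By Schur's test this quadratic form
is bounded on `L²[0,T]`, hence the stochastic integral exists (`exists_isStochIntegral`). Write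
`M_T = ∫_0^T h_T dB` and `v_T = ∫_0^T h_T`. The equation `Γ_T h_T = 1` says that `E M_T B_t = t` for
`t ≤ T`, and consequently `E M_T M_S = v_S` for `S ≤ T`.

*Consistency.* Since `θhat_T = θ + Y_T` with `Y_T = M_T / v_T` and `E Y_T Y_S = 1 / v_T` for
`S ≤ T`, the process `Y` has uncorrelated, hence independent, increments in reversed time, and
Doob's inequality gives `P (sup_{s ∈ D, s ≥ a} |Y_s| ≥ ε) ≤ v_a^{-1/2} / ε` for countable `D`
(`IsReversedGaussianMartingale.measure_exists_mem_countable_le`). It remains to see that `v_T → ∞`.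
By the Cauchy--Schwarz inequality `T² = (E M_T B_T)² ≤ v_T E B_T²`, and `E B_N² = o(N²)` because the
stationary sequence of increments over unit intervals has vanishing correlations
(`tendsto_inv_energy`).

*Separability.* A countable set `S` is chosen such that `{(s, v_s) : s ∈ S}` is dense in
`{(t, v_t) : t > 0}`; then every `Y_t` is a mean square limit of variables `Y_s` with `s ∈ S`. The
maximal inequality bounds the paths on `S`, so that limit values exist at all times
(`IsReversedGaussianMartingale.exists_separable_version`).

*Likelihood.* `B_t = W_t + (t / v_T) M_T` on `[0, T]`, where `W` is independent of `M_T`, and adding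
the drift `ϑ t` replaces `M_T` by `M_T + ϑ v_T`. Comparing the laws `N(ϑ v_T, v_T)` and `N(0, v_T)`
shows that the likelihood is `exp (ϑ m - ϑ² v_T / 2)`, where `m = ∫_0^T h_T dX` as a function of
the observed path (`lintegral_pathOn_observed`, `exists_measurable_pathFunctional`). Its only
maximizer is `ϑ = m / v_T` (`isMLE_of_isStochIntegral`).
-/

noncomputable section

namespace DriftMLE

variable {Ω : Type*} [MeasurableSpace Ω]

/-! ### Mean square limits -/

theorem tendsto_integral_mul_of_tendsto_eLpNorm {α : Type*} [MeasurableSpace α] {μ : Measure α}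
    {X Y : ℕ → α → ℝ} {x y : α → ℝ} (hX : ∀ n, MemLp (X n) 2 μ) (hx : MemLp x 2 μ)
    (hY : ∀ n, MemLp (Y n) 2 μ) (hy : MemLp y 2 μ)
    (hXx : Tendsto (fun n => eLpNorm (fun a => X n a - x a) 2 μ) atTop (𝓝 0))
    (hYy : Tendsto (fun n => eLpNorm (fun a => Y n a - y a) 2 μ) atTop (𝓝 0)) :
    Tendsto (fun n => ∫ a, X n a * Y n a ∂μ) atTop (𝓝 (∫ a, x a * y a ∂μ)) := by
  have key : ∀ {f g : α → ℝ} (hf : MemLp f 2 μ) (hg : MemLp g 2 μ),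
      inner ℝ (hf.toLp f) (hg.toLp g) = ∫ a, f a * g a ∂μ := by
    intro f g hf hg
    rw [L2.inner_def]
    refine integral_congr_ae ?_
    filter_upwards [hf.coeFn_toLp, hg.coeFn_toLp] with a h1 h2
    rw [h1, h2]
    simp [mul_comm]
  have h1 : Tendsto (fun n => (hX n).toLp (X n)) atTop (𝓝 (hx.toLp x)) :=
    (Lp.tendsto_Lp_iff_tendsto_eLpNorm'' _ hX _ hx).2 hXx
  have h2 : Tendsto (fun n => (hY n).toLp (Y n)) atTop (𝓝 (hy.toLp y)) :=
    (Lp.tendsto_Lp_iff_tendsto_eLpNorm'' _ hY _ hy).2 hYy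
  simpa only [key] using h1.inner (𝕜 := ℝ) h2

theorem tendsto_integral_mul_const_of_tendsto_eLpNorm {α : Type*} [MeasurableSpace α]
    {μ : Measure α} {X : ℕ → α → ℝ} {x y : α → ℝ} (hX : ∀ n, MemLp (X n) 2 μ) (hx : MemLp x 2 μ)
    (hy : MemLp y 2 μ)
    (hXx : Tendsto (fun n => eLpNorm (fun a => X n a - x a) 2 μ) atTop (𝓝 0)) :
    Tendsto (fun n => ∫ a, X n a * y a ∂μ) atTop (𝓝 (∫ a, x a * y a ∂μ)) :=
  tendsto_integral_mul_of_tendsto_eLpNorm hX hx (fun _ => hy) hy hXx (by simp)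


theorem ofReal_integral_sq_eq_eLpNorm_sq {α : Type*} [MeasurableSpace α] {μ : Measure α} {f : α → ℝ}
    (hf : MemLp f 2 μ) : ENNReal.ofReal (∫ a, f a ^ 2 ∂μ) = eLpNorm f 2 μ ^ 2 := by
  rw [ofReal_integral_eq_lintegral_ofReal hf.integrable_sq (ae_of_all _ fun a => sq_nonneg _),
    eLpNorm_eq_lintegral_rpow_enorm_toReal (by norm_num) (by norm_num)]
  simp only [ENNReal.toReal_ofNat, one_div]
  rw [← ENNReal.rpow_natCast, ← ENNReal.rpow_mul]
  norm_num
  refine lintegral_congr fun a => ?_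
  rw [← enorm_pow, ← ofReal_norm, Real.norm_of_nonneg (sq_nonneg _)]

theorem norm_exp_mul_I_sub_exp_mul_I_le (x y : ℝ) :
    ‖Complex.exp (x * Complex.I) - Complex.exp (y * Complex.I)‖ ≤ |x - y| := by
  have h : Complex.exp (x * Complex.I) - Complex.exp (y * Complex.I)
      = Complex.exp (y * Complex.I) * (Complex.exp (Complex.I * ((x - y : ℝ) : ℂ)) - 1) := by
    rw [mul_sub, ← Complex.exp_add, mul_one]
    congr 2
    push_cast; ring
  rw [h, norm_mul, Complex.norm_exp_ofReal_mul_I, one_mul]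
  exact Real.norm_exp_I_mul_ofReal_sub_one_le

/-- A mean square limit of Gaussian random variables is Gaussian: the characteristic functions,
the means and the variances all converge. -/
theorem hasGaussianLaw_of_tendsto_eLpNorm {P : Measure Ω} [IsProbabilityMeasure P]
    {G : ℕ → Ω → ℝ} {g : Ω → ℝ} (hG : ∀ n, HasGaussianLaw (G n) P) (hg : MemLp g 2 P)
    (h : Tendsto (fun n => eLpNorm (fun ω => G n ω - g ω) 2 P) atTop (𝓝 0)) :
    HasGaussianLaw g P := by
  have hG2 : ∀ n, MemLp (G n) 2 P := fun n => (hG n).memLp_two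
  rw [hasGaussianLaw_iff_charFun_map_eq hg.aestronglyMeasurable.aemeasurable]
  intro t
  have hval : ∀ {f : Ω → ℝ} (_ : MemLp f 2 P),
      Complex.exp (((∫ ω, inner ℝ t (f ω) ∂P : ℝ) : ℂ) * Complex.I
        - ((Var[fun ω ↦ inner ℝ t (f ω); P] : ℝ) : ℂ) / 2) =
      Complex.exp (((t * ∫ ω, f ω * 1 ∂P : ℝ) : ℂ) * Complex.I
        - ((t ^ 2 * (∫ ω, f ω * f ω ∂P - (∫ ω, f ω * 1 ∂P) ^ 2) : ℝ) : ℂ) / 2) := by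
    intro f hf
    have e : (fun ω ↦ inner ℝ t (f ω)) = fun ω => t * f ω := by
      ext ω; simp [mul_comm]
    rw [e, integral_const_mul, variance_const_mul, variance_eq_sub hf]
    simp [sq]
  rw [hval hg]
  have hm := tendsto_integral_mul_const_of_tendsto_eLpNorm hG2 hg (memLp_const (1 : ℝ)) h
  have hq := tendsto_integral_mul_of_tendsto_eLpNorm hG2 hg hG2 hg h h
  have hr : Tendsto (fun n => Complex.exp (((t * ∫ ω, G n ω * 1 ∂P : ℝ) : ℂ) * Complex.I
        - ((t ^ 2 * (∫ ω, G n ω * G n ω ∂P - (∫ ω, G n ω * 1 ∂P) ^ 2) : ℝ) : ℂ) / 2)) atTop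
      (𝓝 (Complex.exp (((t * ∫ ω, g ω * 1 ∂P : ℝ) : ℂ) * Complex.I
        - ((t ^ 2 * (∫ ω, g ω * g ω ∂P - (∫ ω, g ω * 1 ∂P) ^ 2) : ℝ) : ℂ) / 2))) := by
    refine (Complex.continuous_exp.tendsto _).comp ?_
    refine Tendsto.sub (Tendsto.mul_const _ ?_) (Tendsto.div_const ?_ _)
    · exact (Complex.continuous_ofReal.tendsto _).comp (hm.const_mul t)
    · exact (Complex.continuous_ofReal.tendsto _).comp ((hq.sub (hm.pow 2)).const_mul (t ^ 2))
  have hcf : ∀ {f : Ω → ℝ} (_ : MemLp f 2 P), charFun (P.map f) t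
      = ∫ ω, Complex.exp ((t * f ω : ℝ) * Complex.I) ∂P := by
    intro f hf
    rw [charFun_apply_real, integral_map hf.aestronglyMeasurable.aemeasurable (by fun_prop)]
    simp
  have hint : ∀ {f : Ω → ℝ} (_ : MemLp f 2 P),
      Integrable (fun ω => Complex.exp ((t * f ω : ℝ) * Complex.I)) P := by
    intro f hf
    have hfm := hf.aestronglyMeasurable.aemeasurable
    refine Integrable.of_bound (C := 1) ?_ (ae_of_all _ fun ω => ?_)
    · exact (by fun_prop : AEMeasurable (fun ω => Complex.exp ((t * f ω : ℝ) * Complex.I))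
        P).aestronglyMeasurable
    · rw [Complex.norm_exp_ofReal_mul_I]
  have hl : Tendsto (fun n => charFun (P.map (G n)) t) atTop (𝓝 (charFun (P.map g) t)) := by
    rw [tendsto_iff_norm_sub_tendsto_zero]
    have hb : Tendsto (fun n => |t| * (eLpNorm (fun ω => G n ω - g ω) 2 P).toReal) atTop (𝓝 0) := by
      have := (ENNReal.tendsto_toReal (by simp)).comp h
      simpa using this.const_mul |t|
    refine squeeze_zero (fun n => norm_nonneg _) (fun n => ?_) hb
    have hd : MemLp (fun ω => G n ω - g ω) 2 P := (hG2 n).sub hg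
    have hd1 : Integrable (fun ω => G n ω - g ω) P := hd.integrable (by norm_num)
    rw [hcf (hG2 n), hcf hg, ← integral_sub (hint (hG2 n)) (hint hg)]
    calc _ ≤ ∫ ω, |t| * ‖G n ω - g ω‖ ∂P := by
          refine norm_integral_le_of_norm_le (hd1.norm.const_mul _) (ae_of_all _ fun ω => ?_)
          refine (norm_exp_mul_I_sub_exp_mul_I_le _ _).trans_eq ?_
          rw [← mul_sub, abs_mul, Real.norm_eq_abs]
      _ = |t| * (eLpNorm (fun ω => G n ω - g ω) 1 P).toReal := by
          rw [integral_const_mul, integral_norm_eq_lintegral_enorm hd1.aestronglyMeasurable,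
            eLpNorm_one_eq_lintegral_enorm]
      _ ≤ _ := by
          gcongr
          · exact hd.eLpNorm_ne_top
          · exact eLpNorm_le_eLpNorm_of_exponent_le (by norm_num) hd.aestronglyMeasurable
  refine tendsto_nhds_unique hl (hr.congr fun n => ?_)
  rw [(hG n).charFun_map_eq t, hval (hG2 n)]

theorem isGaussianProcess_of_tendsto_eLpNorm {P : Measure Ω} [IsProbabilityMeasure P] {ι : Type*}
    {G : ℕ → ι → Ω → ℝ} {g : ι → Ω → ℝ} (hG : ∀ n, IsGaussianProcess (G n) P)
    (hg : ∀ i, MemLp (g i) 2 P)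
    (h : ∀ i, Tendsto (fun n => eLpNorm (fun ω => G n i ω - g i ω) 2 P) atTop (𝓝 0)) :
    IsGaussianProcess g P := by
  classical
  refine ⟨fun I => ?_⟩
  have hmeas : AEMeasurable (fun ω => I.restrict (g · ω)) P :=
    aemeasurable_pi_lambda _ fun i => (hg i).aestronglyMeasurable.aemeasurable
  have hlin : ∀ (L : StrongDual ℝ (I → ℝ)), HasGaussianLaw (fun ω => L (I.restrict (g · ω))) P := by
    intro L
    obtain ⟨c, hL⟩ : ∃ c : I → ℝ, ∀ x : I → ℝ, L x = ∑ i, c i * x i := by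
      refine ⟨fun i => L fun j => if i = j then 1 else 0, fun x => ?_⟩
      refine (LinearMap.pi_apply_eq_sum_univ L.toLinearMap x).trans ?_
      exact Finset.sum_congr rfl fun i _ => mul_comm _ _
    refine hasGaussianLaw_of_tendsto_eLpNorm
      (G := fun n ω => L (I.restrict (G n · ω))) (fun n => ?_) ?_ ?_
    · exact ((hG n).hasGaussianLaw I).map_fun L
    · simp only [hL]
      exact memLp_finsetSum _ fun i _ => (hg i).const_mul _
    · have hb : Tendsto (fun n => ∑ i : I, ‖c i‖ₑ *
          eLpNorm (fun ω => G n i ω - g i ω) 2 P) atTop (𝓝 0) := by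
        have : (0 : ℝ≥0∞) = ∑ i : I, ‖c i‖ₑ * 0 := by simp
        rw [this]
        exact tendsto_finsetSum _ fun i _ =>
          ENNReal.Tendsto.const_mul (h i) (Or.inr (by simp))
      refine tendsto_of_tendsto_of_tendsto_of_le_of_le tendsto_const_nhds hb
        (fun n => zero_le) fun n => ?_
      have e : (fun ω => L (I.restrict (G n · ω)) - L (I.restrict (g · ω)))
          = ∑ i : I, c i • (fun ω => G n i ω - g i ω) := by
        ext ω
        rw [hL, hL, ← Finset.sum_sub_distrib]
        simp [mul_sub]
      rw [e]
      refine (eLpNorm_sum_le (fun i _ => ?_) (by norm_num)).trans ?_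
      · exact (((hG n).hasGaussianLaw_eval i).memLp_two.sub
          (hg i)).aestronglyMeasurable.const_smul _
      · exact Finset.sum_le_sum fun i _ => (eLpNorm_const_smul _ _ _ _).le
  refine (hasGaussianLaw_iff_charFunDual_map_eq hmeas).2 fun L => ?_
  have hLg := (hlin L).charFun_map_eq 1
  have : charFunDual (P.map (fun ω => I.restrict (g · ω))) L
      = charFun (P.map (fun ω => L (I.restrict (g · ω)))) 1 := by
    rw [charFunDual_eq_charFun_map_one, AEMeasurable.map_map_of_aemeasurable (by fun_prop) hmeas]
    rfl
  rw [this, hLg]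
  simp [Function.comp_def]

/-! ### A maximal inequality for Gaussian martingales -/

/-- Doob's inequality for a centered Gaussian sequence with uncorrelated increments: such a
sequence is a martingale, since for Gaussian vectors uncorrelated means independent. -/
theorem measure_exists_le_abs_le {P : Measure Ω} [IsProbabilityMeasure P] {Z : ℕ → Ω → ℝ}
    (hZ : IsGaussianProcess Z P) (hm : ∀ k, Measurable (Z k)) (hc : ∀ k, ∫ ω, Z k ω ∂P = 0)
    (horth : ∀ j k, j ≤ k → ∫ ω, Z (k + 1) ω * Z j ω ∂P = ∫ ω, Z k ω * Z j ω ∂P)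
    (n : ℕ) {ε : ℝ} (hε : 0 < ε) :
    P {ω | ∃ k ≤ n, ε ≤ |Z k ω|} ≤ ENNReal.ofReal (√(∫ ω, Z n ω ^ 2 ∂P) / ε) := by
  have h2 : ∀ k, MemLp (Z k) 2 P := fun k => (hZ.hasGaussianLaw_eval k).memLp_two
  have hint : ∀ k, Integrable (Z k) P := fun k => (hZ.hasGaussianLaw_eval k).integrable
  let F := Filtration.natural Z (fun k => (hm k).stronglyMeasurable)
  have hadap : StronglyAdapted F Z := Filtration.stronglyAdapted_natural _
  have hmart : Martingale Z F P := by
    refine martingale_nat hadap hint fun k => ?_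
    have hd : Measurable (fun ω => Z (k + 1) ω - Z k ω) := (hm _).sub (hm _)
    have hind : IndepFun (fun ω (_ : Unit) => Z (k + 1) ω - Z k ω)
        (fun ω (j : Set.Iic k) => Z j ω) P := by
      refine IsGaussianProcess.indepFun_of_covariance_eq_zero
        (X := fun (_ : Unit) ω => Z (k + 1) ω - Z k ω) (Y := fun (j : Set.Iic k) ω => Z j ω)
        ?_ (fun _ => hd.aemeasurable) (fun j => (hm j).aemeasurable) ?_
      · refine hZ.of_isGaussianProcess fun s => ?_
        rcases s with s | s
        · exact ⟨{k, k + 1},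
            { toFun x := x ⟨k + 1, by simp⟩ - x ⟨k, by simp⟩
              map_add' x y := by simp; ring
              map_smul' c x := by simp; ring }, fun ω => by simp⟩
        · exact ⟨{(s : ℕ)},
            { toFun x := x ⟨s, by simp⟩
              map_add' x y := by simp
              map_smul' c x := by simp }, fun ω => by simp⟩
      · intro _ j
        rw [covariance_eq_sub (X := fun ω => Z (k + 1) ω - Z k ω) ((h2 (k + 1)).sub (h2 k)) (h2 _)]
        have e1 : ∫ ω, ((fun ω => Z (k + 1) ω - Z k ω) * (fun ω => Z j ω)) ω ∂P = 0 := by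
          simp only [Pi.mul_apply, sub_mul]
          exact (integral_sub ((h2 (k + 1)).integrable_mul (h2 j))
            ((h2 k).integrable_mul (h2 j))).trans (sub_eq_zero.2 (horth j k j.2))
        rw [e1, hc j]
        simp
    have hind' : Indep (MeasurableSpace.comap (fun ω => Z (k + 1) ω - Z k ω) inferInstance)
        (F k) P := by
      have h3 : IndepFun (fun ω => Z (k + 1) ω - Z k ω) (fun ω (j : Set.Iic k) => Z j ω) P :=
        hind.comp (measurable_pi_apply ()) measurable_id
      have h4 : (F k : MeasurableSpace Ω)
          = .comap (fun ω (j : Set.Iic k) ↦ Z j ω) inferInstance :=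
        Filtration.natural_eq_comap _ _ _
      rw [h4]
      exact h3
    have hce : P[fun ω => Z (k + 1) ω - Z k ω | F k] =ᵐ[P] fun _ => 0 := by
      have := condExp_indep_eq hd.comap_le (F.le k)
        (comap_measurable (fun ω => Z (k + 1) ω - Z k ω)).stronglyMeasurable hind'
      refine this.trans (ae_of_all _ fun ω => ?_)
      rw [integral_sub (hint _) (hint _), hc, hc, sub_zero]
    have hs : P[Z (k + 1) - Z k | F k] =ᵐ[P] P[Z (k + 1) | F k] - P[Z k | F k] :=
      condExp_sub (hint _) (hint _) _
    have hk : P[Z k | F k] = Z k := condExp_of_stronglyMeasurable (F.le k) (hadap k) (hint k)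
    rw [hk] at hs
    have hce' : P[Z (k + 1) - Z k | F k] =ᵐ[P] fun _ => 0 := hce
    filter_upwards [hs, hce'] with ω a b
    have : (0 : ℝ) = (P[Z (k + 1) | F k]) ω - Z k ω := by rw [← b, a]; rfl
    linarith
  have hsub : Submartingale (fun k => Z k ⊔ (-Z) k) F P :=
    hmart.submartingale.sup hmart.neg.submartingale
  have habs : (fun k => Z k ⊔ (-Z) k) = fun k ω => |Z k ω| := by
    ext k ω; simp [abs]
  rw [habs] at hsub
  lift ε to ℝ≥0 using hε.le
  have hmax := maximal_ineq hsub (fun k ω => abs_nonneg _) (ε := ε) n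
  have hset : {ω | ∃ k ≤ n, (ε : ℝ) ≤ |Z k ω|} = {ω | (ε : ℝ) ≤
      (Finset.range (n + 1)).sup' Finset.nonempty_range_add_one fun k => |Z k ω|} := by
    ext ω
    simp [Finset.le_sup'_iff]
  rw [← hset] at hmax
  have hle : ∫ ω in {ω | ∃ k ≤ n, (ε : ℝ) ≤ |Z k ω|}, |Z n ω| ∂P ≤ √(∫ ω, Z n ω ^ 2 ∂P) := by
    refine (setIntegral_le_integral (hint n).abs (ae_of_all _ fun ω => abs_nonneg _)).trans ?_
    refine Real.le_sqrt_of_sq_le ?_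
    have hv := variance_nonneg (fun ω => |Z n ω|) P
    rw [variance_eq_sub (X := fun ω => |Z n ω|) (h2 n).abs] at hv
    simp only [Pi.pow_apply, sq_abs] at hv
    linarith
  rw [ENNReal.ofReal_div_of_pos hε, ENNReal.le_div_iff_mul_le (Or.inl (by simpa using hε.ne'))
    (Or.inl (by simp)), mul_comm, ENNReal.ofReal_coe_nnreal]
  exact hmax.trans (ENNReal.ofReal_le_ofReal hle)

/-! ### The covariance kernel -/

section Kernel

variable {K : ℝ → ℝ}

theorem intervalIntegrable_of_integrableOn_Icc
    (hK : ∀ T : ℝ, 0 < T → IntegrableOn K (Icc (-T) T)) (a b : ℝ) :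
    IntervalIntegrable K volume a b := by
  have hT : 0 < |a| + |b| + 1 := by positivity
  have h := hK _ hT
  refine (h.mono_set ?_).intervalIntegrable
  intro x hx
  rw [mem_uIcc] at hx
  have h1 := abs_le.1 (le_refl |a|)
  have h2 := abs_le.1 (le_refl |b|)
  constructor <;> rcases hx with hx | hx <;> linarith [hx.1, hx.2, h1.1, h1.2, h2.1, h2.2]

/-- The covariance density `∂R/∂t (t, s) = ∫_0^s K(t-u) du` of `B_t` with respect to the first
time argument. -/
def kernelPrimitive (K : ℝ → ℝ) (t s : ℝ) : ℝ := ∫ u in (0 : ℝ)..s, K (t - u)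

theorem continuous_kernelPrimitive (hK : ∀ T : ℝ, 0 < T → IntegrableOn K (Icc (-T) T)) (s : ℝ) :
    Continuous fun t => kernelPrimitive K t s := by
  have hi := intervalIntegrable_of_integrableOn_Icc hK
  have h : (fun t => kernelPrimitive K t s)
      = fun t => (∫ u in (0 : ℝ)..t, K u) - ∫ u in (0 : ℝ)..(t - s), K u := by
    ext t
    rw [kernelPrimitive, intervalIntegral.integral_comp_sub_left (fun u => K u), sub_zero,
      intervalIntegral.integral_interval_sub_left (hi _ _) (hi _ _)]
  rw [h]
  have hc := intervalIntegral.continuous_primitive hi 0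
  exact hc.sub (hc.comp (by fun_prop))

theorem kernelPrimitive_sub (hK : ∀ T : ℝ, 0 < T → IntegrableOn K (Icc (-T) T)) (t a b : ℝ) :
    kernelPrimitive K t b - kernelPrimitive K t a = ∫ u in a..b, K (t - u) := by
  have hi : ∀ a b, IntervalIntegrable (fun u => K (t - u)) volume a b := by
    intro a b
    have := (intervalIntegrable_of_integrableOn_Icc hK (t - a) (t - b)).comp_sub_left (c := t)
    simpa using this
  exact intervalIntegral.integral_interval_sub_left (hi _ _) (hi _ _)

/-- Integrating the mixed derivative twice recovers `R` from its zero boundary values. -/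
theorem HasMixedDeriv.eq_integral {R : ℝ → ℝ → ℝ}
    (hR : HasMixedDeriv R (fun t s => K (t - s)))
    (hK : ∀ T : ℝ, 0 < T → IntegrableOn K (Icc (-T) T))
    (h1 : ∀ t, R t 0 = 0) (h2 : ∀ s, R 0 s = 0) {t s : ℝ} (ht : 0 ≤ t) (hs : 0 ≤ s) :
    R t s = ∫ τ in (0 : ℝ)..t, kernelPrimitive K τ s := by
  obtain ⟨D, hD, hDac⟩ := hR
  have hD0 : ∀ t, 0 ≤ t → D t 0 = 0 := by
    intro t ht
    have h := hD t 0 ht le_rfl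
    simp only [h1] at h
    exact (uniqueDiffOn_Ici (0 : ℝ) t ht).eq_deriv _ h (hasDerivWithinAt_const _ _ _)
  have hDk : ∀ t, 0 ≤ t → D t s = kernelPrimitive K t s := by
    intro t ht
    rcases hs.eq_or_lt with rfl | hs'
    · simp [hD0 t ht, kernelPrimitive]
    · obtain ⟨hac, hder⟩ := hDac t ht
      have h := (hac s hs').integral_deriv_eq_sub
      rw [hD0 t ht, sub_zero] at h
      rw [← h, kernelPrimitive]
      refine intervalIntegral.integral_congr_ae ?_
      rw [ae_restrict_iff' measurableSet_Ioi] at hder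
      filter_upwards [hder] with u hu hu'
      rw [uIoc_of_le hs] at hu'
      exact (hu hu'.1).deriv
  have hcont : ContinuousOn (fun τ => R τ s) (Icc 0 t) := fun τ hτ =>
    ((hD τ s hτ.1 hs).continuousWithinAt).mono Icc_subset_Ici_self
  have hderiv : ∀ τ ∈ Ioo 0 t, HasDerivAt (fun τ => R τ s) (kernelPrimitive K τ s) τ := by
    intro τ hτ
    rw [← hDk τ hτ.1.le]
    exact (hD τ s hτ.1.le hs).hasDerivAt (Ici_mem_nhds hτ.1)
  have := intervalIntegral.integral_eq_sub_of_hasDerivAt_of_le ht hcont hderiv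
    ((continuous_kernelPrimitive hK s).intervalIntegrable _ _)
  rw [this, h2, sub_zero]

/-- Schur's test for a convolution quadratic form: `|G(t) G(u)| ≤ (G(t)² + G(u)²) / 2`, and both
squares contribute `‖κ‖₁ ‖G‖₂² / 2`. -/
theorem norm_integral_mul_conv_le {κ G : ℝ → ℝ} (hκ : Integrable κ)
    (hG : Integrable (fun t => G t ^ 2)) :
    ‖∫ t, G t * ∫ u, κ (t - u) * G u‖ ≤ (∫ t, ‖κ t‖) * ∫ t, G t ^ 2 := by
  have hκn : Integrable (fun t => ‖κ t‖) := hκ.norm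
  set c : ℝ := ∫ t, ‖κ t‖ with hc
  have hconv := hG.integrable_convolution (ContinuousLinearMap.mul ℝ ℝ) hκn
  have hb : Integrable (fun t => (1 / 2) * (G t ^ 2 * c)
      + (1 / 2) * convolution (fun t => G t ^ 2) (fun t => ‖κ t‖)
        (ContinuousLinearMap.mul ℝ ℝ) volume t) :=
    ((hG.mul_const c).const_mul _).add (hconv.const_mul _)
  have hval : ∫ t, ((1 / 2) * (G t ^ 2 * c)
      + (1 / 2) * convolution (fun t => G t ^ 2) (fun t => ‖κ t‖)
        (ContinuousLinearMap.mul ℝ ℝ) volume t)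
      = c * ∫ t, G t ^ 2 := by
    rw [integral_add ((hG.mul_const c).const_mul _) (hconv.const_mul _), integral_const_mul,
      integral_const_mul, integral_mul_const, integral_convolution _ hG hκn]
    simp only [ContinuousLinearMap.mul_apply']
    ring
  rw [← hval]
  refine norm_integral_le_of_norm_le hb ?_
  filter_upwards [hG.ae_convolution_exists (ContinuousLinearMap.mul ℝ ℝ) hκn] with t ht
  have ht' : Integrable (fun u => G u ^ 2 * ‖κ (t - u)‖) := ht
  have hk' : Integrable (fun u => ‖κ (t - u)‖) := hκn.comp_sub_left t
  have hck : c = ∫ u, ‖κ (t - u)‖ := (integral_sub_left_eq_self (fun u => ‖κ u‖) volume t).symm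
  rw [← integral_const_mul]
  have hb' : Integrable (fun u => (1 / 2) * (G t ^ 2 * ‖κ (t - u)‖)
      + (1 / 2) * (G u ^ 2 * ‖κ (t - u)‖)) :=
    ((hk'.const_mul _).const_mul _).add (ht'.const_mul _)
  have hval' : ∫ u, ((1 / 2) * (G t ^ 2 * ‖κ (t - u)‖) + (1 / 2) * (G u ^ 2 * ‖κ (t - u)‖))
      = (1 / 2) * (G t ^ 2 * c) + (1 / 2) * convolution (fun t => G t ^ 2) (fun t => ‖κ t‖)
        (ContinuousLinearMap.mul ℝ ℝ) volume t := by
    rw [integral_add ((hk'.const_mul _).const_mul _) (ht'.const_mul _), integral_const_mul,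
      integral_const_mul, integral_const_mul, ← hck]
    rfl
  rw [← hval']
  refine norm_integral_le_of_norm_le hb' (ae_of_all _ fun u => ?_)
  rw [norm_mul, norm_mul, Real.norm_eq_abs (G t), Real.norm_eq_abs (G u), ← sq_abs (G t),
    ← sq_abs (G u)]
  nlinarith [mul_nonneg (norm_nonneg (κ (t - u))) (sq_nonneg (|G t| - |G u|))]

theorem integrable_indicator_kernel (hK : ∀ T : ℝ, 0 < T → IntegrableOn K (Icc (-T) T))
    {T : ℝ} (hT : 0 < T) : Integrable ((Icc (-T) T).indicator K) :=
  (integrable_indicator_iff measurableSet_Icc).2 (hK T hT)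

/-- On `[0, T]` only the values of `K` on `[-T, T]` matter, so that `Γ_T f` is a convolution of
functions on the line. -/
theorem covOp_eq_integral_indicator (T : ℝ≥0) (f : ℝ → ℝ) {t : ℝ} (ht : t ∈ Icc (0 : ℝ) T) :
    covOp K T f t
      = ∫ u, (Icc (-(T : ℝ)) T).indicator K (t - u) * (Ioc (0 : ℝ) T).indicator f u := by
  rw [covOp, intervalIntegral.integral_of_le T.coe_nonneg, ← integral_indicator measurableSet_Ioc]
  congr 1
  ext u
  by_cases hu : u ∈ Ioc (0 : ℝ) T
  · rw [indicator_of_mem hu, indicator_of_mem hu, indicator_of_mem]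
    exact ⟨by linarith [ht.1, hu.2], by linarith [ht.2, hu.1]⟩
  · rw [indicator_of_notMem hu, indicator_of_notMem hu, mul_zero]

theorem integral_mul_covOp_le (hK : ∀ T : ℝ, 0 < T → IntegrableOn K (Icc (-T) T))
    {T : ℝ≥0} (hT : 0 < T) {g : ℝ → ℝ} (hg : MemLp g 2 (volume.restrict (Icc (0 : ℝ) T))) :
    ∫ t in (0 : ℝ)..T, g t * covOp K T g t
      ≤ (∫ t, ‖(Icc (-(T : ℝ)) T).indicator K t‖) * ∫ t in Icc (0 : ℝ) T, g t ^ 2 := by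
  have hG : Integrable (fun t => (Ioc (0 : ℝ) T).indicator g t ^ 2) := by
    have : (fun t => (Ioc (0 : ℝ) T).indicator g t ^ 2)
        = (Ioc (0 : ℝ) T).indicator fun t => g t ^ 2 := by
      ext t; by_cases h : t ∈ Ioc (0 : ℝ) T <;> simp [h]
    rw [this, integrable_indicator_iff measurableSet_Ioc]
    exact IntegrableOn.mono_set hg.integrable_sq Ioc_subset_Icc_self
  have h := norm_integral_mul_conv_le
    (integrable_indicator_kernel hK (T := T) (by exact_mod_cast hT)) hG
  have e1 : ∫ t in (0 : ℝ)..T, g t * covOp K T g t = ∫ t, (Ioc (0 : ℝ) T).indicator g t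
      * ∫ u, (Icc (-(T : ℝ)) T).indicator K (t - u) * (Ioc (0 : ℝ) T).indicator g u := by
    rw [intervalIntegral.integral_of_le T.coe_nonneg, ← integral_indicator measurableSet_Ioc]
    congr 1
    ext t
    by_cases ht : t ∈ Ioc (0 : ℝ) T
    · rw [indicator_of_mem ht, indicator_of_mem ht, covOp_eq_integral_indicator T g
        (Ioc_subset_Icc_self ht)]
    · rw [indicator_of_notMem ht, indicator_of_notMem ht, zero_mul]
  have e2 : ∫ t, (Ioc (0 : ℝ) T).indicator g t ^ 2 = ∫ t in Icc (0 : ℝ) T, g t ^ 2 := by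
    rw [integral_Icc_eq_integral_Ioc, ← integral_indicator measurableSet_Ioc]
    congr 1
    ext t; by_cases h : t ∈ Ioc (0 : ℝ) T <;> simp [h]
  rw [e1, ← e2]
  exact (le_abs_self _).trans h

/-- Fubini's theorem, with `K` even: `Γ_T` is symmetric, and `kernelPrimitive K · t` is the image of
the indicator of `[0, t]`. -/
theorem integral_mul_kernelPrimitive (hK : ∀ T : ℝ, 0 < T → IntegrableOn K (Icc (-T) T))
    (heven : ∀ t, K (-t) = K t) {T : ℝ≥0} (hT : 0 < T) {f : ℝ → ℝ}
    (hf : IntegrableOn f (Icc (0 : ℝ) T)) {t : ℝ} (ht : t ∈ Icc (0 : ℝ) T) :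
    ∫ τ in (0 : ℝ)..T, f τ * kernelPrimitive K τ t = ∫ u in (0 : ℝ)..t, covOp K T f u := by
  have hT' : (0 : ℝ) < T := by exact_mod_cast hT
  have hF : Integrable ((Ioc (0 : ℝ) T).indicator f) :=
    (integrable_indicator_iff measurableSet_Ioc).2 (hf.mono_set Ioc_subset_Icc_self)
  have hprod := hF.convolution_integrand (ContinuousLinearMap.mul ℝ ℝ)
    (integrable_indicator_kernel hK hT')
  have hprod' : Integrable (fun p : ℝ × ℝ => K (p.1 - p.2) * f p.2)
      ((volume.restrict (Ioc 0 t)).prod (volume.restrict (Ioc (0 : ℝ) T))) := by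
    rw [Measure.prod_restrict]
    refine (integrableOn_congr_fun ?_ (measurableSet_Ioc.prod measurableSet_Ioc)).1
      hprod.integrableOn
    rintro ⟨u, τ⟩ ⟨hu, hτ⟩
    have hu1 : 0 < u := hu.1
    have hu2 : u ≤ t := hu.2
    have hτ1 : 0 < τ := hτ.1
    have hτ2 : τ ≤ T := hτ.2
    have hmem : u - τ ∈ Icc (-(T : ℝ)) T := ⟨by linarith, by linarith [ht.2]⟩
    have hmem2 : τ ∈ Ioc (0 : ℝ) T := hτ
    simp only [ContinuousLinearMap.mul_apply', indicator_of_mem hmem, indicator_of_mem hmem2]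
    ring
  simp only [covOp]
  rw [intervalIntegral.integral_of_le hT'.le, intervalIntegral.integral_of_le ht.1]
  simp only [intervalIntegral.integral_of_le hT'.le]
  rw [integral_integral_swap hprod']
  congr 1
  ext τ
  rw [kernelPrimitive, intervalIntegral.integral_of_le ht.1, ← integral_const_mul]
  congr 1
  ext u
  rw [← heven (u - τ), neg_sub, mul_comm]

end Kernel

/-! ### Step functions -/

namespace Step

variable {T : ℝ≥0}

/-- The difference of two step functions, obtained by concatenating the two lists of intervals. -/
def sub (g g' : Step T) : Step T where
  n := g.n + g'.n
  left := Fin.append g.left g'.left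
  right := Fin.append g.right g'.right
  coeff := Fin.append g.coeff (fun i => -g'.coeff i)
  left_le_right i := by
    refine Fin.addCases (fun i => ?_) (fun i => ?_) i
    · simpa using g.left_le_right i
    · simpa using g'.left_le_right i
  right_le i := by
    refine Fin.addCases (fun i => ?_) (fun i => ?_) i
    · simpa using g.right_le i
    · simpa using g'.right_le i

theorem toFun_sub (g g' : Step T) (u : ℝ) : (g.sub g').toFun u = g.toFun u - g'.toFun u := by
  refine (Fin.sum_univ_add (a := g.n) (b := g'.n) _).trans ?_
  simp [toFun, sub, sub_eq_add_neg]

omit [MeasurableSpace Ω] in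
theorem integral_sub (g g' : Step T) (X : ℝ≥0 → Ω → ℝ) (ω : Ω) :
    (g.sub g').integral X ω = g.integral X ω - g'.integral X ω := by
  refine (Fin.sum_univ_add (a := g.n) (b := g'.n) _).trans ?_
  simp [integral, sub, sub_eq_add_neg]

theorem Ioc_subset (g : Step T) (i : Fin g.n) :
    Ioc (g.left i : ℝ) (g.right i) ⊆ Ioc (0 : ℝ) T :=
  Ioc_subset_Ioc (g.left i).coe_nonneg (by exact_mod_cast g.right_le i)

theorem memLp_toFun (g : Step T) : MemLp g.toFun 2 (volume.restrict (Icc (0 : ℝ) T)) := by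
  unfold toFun
  refine memLp_finsetSum _ fun i _ => ?_
  exact ((memLp_const (1 : ℝ)).indicator measurableSet_Ioc).const_mul _

/-- The integral of a step function against a locally integrable weight. -/
theorem integral_toFun_mul (g : Step T) {φ : ℝ → ℝ}
    (hφ : IntervalIntegrable φ volume 0 T) :
    ∫ u in (0 : ℝ)..T, g.toFun u * φ u
      = ∑ i, g.coeff i * ∫ u in (g.left i : ℝ)..g.right i, φ u := by
  have hφ' : IntegrableOn φ (Ioc (0 : ℝ) T) :=
    (intervalIntegrable_iff_integrableOn_Ioc_of_le T.coe_nonneg).1 hφ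
  have e : ∀ u, g.toFun u * φ u
      = ∑ i, g.coeff i * (Ioc (g.left i : ℝ) (g.right i)).indicator φ u := by
    intro u
    rw [toFun, Finset.sum_mul]
    refine Finset.sum_congr rfl fun i _ => ?_
    by_cases hu : u ∈ Ioc (g.left i : ℝ) (g.right i) <;> simp [hu]
  simp only [e]
  rw [intervalIntegral.integral_of_le T.coe_nonneg, integral_finsetSum]
  · refine Finset.sum_congr rfl fun i _ => ?_
    rw [integral_const_mul, intervalIntegral.integral_of_le (by exact_mod_cast g.left_le_right i),
      setIntegral_indicator measurableSet_Ioc, inter_eq_right.2 (g.Ioc_subset i)]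
  · intro i _
    exact (hφ'.integrable.indicator measurableSet_Ioc).const_mul _

theorem integral_toFun (g : Step T) :
    ∫ u in (0 : ℝ)..T, g.toFun u = ∑ i, g.coeff i * ((g.right i : ℝ) - g.left i) := by
  have := g.integral_toFun_mul (φ := fun _ => 1) (by simp)
  simpa using this

omit [MeasurableSpace Ω] in
theorem integral_observed (g : Step T) (θ : ℝ) (B : ℝ≥0 → Ω → ℝ) (ω : Ω) :
    g.integral (observed θ B) ω = θ * (∫ u in (0 : ℝ)..T, g.toFun u) + g.integral B ω := by
  rw [integral_toFun, integral, integral, Finset.mul_sum, ← Finset.sum_add_distrib]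
  refine Finset.sum_congr rfl fun i _ => ?_
  simp only [observed]
  ring

/-- The step function which samples `f` at the left end points of `n` equal pieces of `[0, T]`. -/
def sample (T : ℝ≥0) (f : ℝ → ℝ) (n : ℕ) : Step T where
  n := n
  left i := T * (i / n)
  right i := T * ((i + 1) / n)
  coeff i := f (T * (i / n))
  left_le_right i := by gcongr; simp
  right_le i := by
    have hn : (0 : ℝ≥0) < n := by exact_mod_cast i.pos
    have : ((i : ℝ≥0) + 1) / n ≤ 1 := by
      rw [div_le_one hn]; exact_mod_cast i.2
    calc T * (((i : ℝ≥0) + 1) / n) ≤ T * 1 := by gcongr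
      _ = T := mul_one T

/-- The sampled step function takes at `u` the value of `f` at a point within `T / n` of `u`. -/
theorem exists_sample_eq (hT : 0 < T) (f : ℝ → ℝ) {n : ℕ} (hn : 0 < n) {u : ℝ}
    (hu : u ∈ Ioc (0 : ℝ) T) :
    ∃ s : ℝ, s ∈ Icc (0 : ℝ) T ∧ |u - s| ≤ T / n ∧ (sample T f n).toFun u = f s := by
  have hT' : (0 : ℝ) < T := by exact_mod_cast hT
  have hn' : (0 : ℝ) < n := by exact_mod_cast hn
  -- the index of the piece containing `u`
  have hx0 : 0 < u * n / T := by have := hu.1; positivity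
  have hc : 0 < ⌈u * n / T⌉₊ := Nat.ceil_pos.2 hx0
  obtain ⟨k, hk⟩ : ∃ k, ⌈u * n / T⌉₊ = k + 1 := ⟨_, (Nat.succ_pred_eq_of_pos hc).symm⟩
  have hk1 : (k : ℝ) < u * n / T := by
    have : k < ⌈u * n / T⌉₊ := by omega
    exact Nat.lt_ceil.1 this
  have hk2 : u * n / T ≤ k + 1 := by
    have := Nat.le_ceil (u * n / T)
    rw [hk] at this
    exact_mod_cast this
  have hkn : k < n := by
    have h1 : u * n / T ≤ n := by
      rw [div_le_iff₀ hT']; nlinarith [hu.2]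
    exact_mod_cast hk1.trans_le h1
  have hmem : ∀ i : Fin n, u ∈ Ioc ((T * ((i : ℝ≥0) / n) : ℝ≥0) : ℝ)
      ((T * (((i : ℝ≥0) + 1) / n) : ℝ≥0) : ℝ)
      ↔ (i : ℝ) < u * n / T ∧ u * n / T ≤ i + 1 := by
    intro i
    push_cast
    rw [mem_Ioc, lt_div_iff₀ hT', div_le_iff₀ hT', ← mul_div_assoc, ← mul_div_assoc,
      div_lt_iff₀ hn', le_div_iff₀ hn', mul_comm (T : ℝ), mul_comm (T : ℝ)]
  have h1 : (T : ℝ) * (k / n) < u := by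
    have := ((hmem ⟨k, hkn⟩).2 ⟨by exact_mod_cast hk1, by exact_mod_cast hk2⟩).1
    push_cast at this; exact this
  have h2 : u ≤ (T : ℝ) * ((k + 1) / n) := by
    have := ((hmem ⟨k, hkn⟩).2 ⟨by exact_mod_cast hk1, by exact_mod_cast hk2⟩).2
    push_cast at this; exact this
  refine ⟨T * (k / n), ⟨by positivity, h1.le.trans hu.2⟩, ?_, ?_⟩
  · rw [abs_of_pos (by linarith)]
    have : (T : ℝ) * ((k + 1) / n) = T * (k / n) + T / n := by ring
    linarith
  · refine (Finset.sum_eq_single (⟨k, hkn⟩ : Fin n) ?_ ?_).trans ?_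
    rotate_left 2
    · have := (hmem ⟨k, hkn⟩).2 ⟨by exact_mod_cast hk1, by exact_mod_cast hk2⟩
      simp only [sample]
      rw [indicator_of_mem this, mul_one]
    · intro i _ hi
      simp only [sample]
      rw [indicator_of_notMem, mul_zero]
      rw [hmem]
      rintro ⟨h3, h4⟩
      apply hi
      have a1 : (i : ℝ) < k + 1 := h3.trans_le hk2
      have a2 : (k : ℝ) < i + 1 := hk1.trans_le h4
      have b1 : (i : ℕ) < k + 1 := by exact_mod_cast a1
      have b2 : k < (i : ℕ) + 1 := by exact_mod_cast a2
      exact Fin.ext (by simp; omega)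
    · exact fun h => absurd (Finset.mem_univ _) h

/-- Step functions are dense in `L²[0,T]`. -/
theorem exists_tendsto (hT : 0 < T) {f : ℝ → ℝ} (hf : MemLp f 2 (volume.restrict (Icc (0 : ℝ) T))) :
    ∃ g : ℕ → Step T, Tendsto (fun n => eLpNorm (fun u => (g n).toFun u - f u) 2
        (volume.restrict (Icc (0 : ℝ) T))) atTop (𝓝 0) := by
  have hT' : (0 : ℝ) < T := by exact_mod_cast hT
  set μ := volume.restrict (Icc (0 : ℝ) T) with hμ
  have key : ∀ ε : ℝ≥0∞, 0 < ε → ∃ g : Step T, eLpNorm (fun u => g.toFun u - f u) 2 μ ≤ ε := by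
    intro ε hε
    obtain ⟨φ, -, hφ, hφc, -⟩ := hf.exists_hasCompactSupport_eLpNorm_sub_le (by simp)
      (ε := ε / 2) (ENNReal.half_pos hε.ne').ne'
    have hlim : Tendsto (fun n : ℕ => eLpNorm (fun u => (sample T φ (n + 1)).toFun u - φ u) 2 μ)
        atTop (𝓝 0) := by
      have huc : UniformContinuousOn φ (Icc (0 : ℝ) T) :=
        isCompact_Icc.uniformContinuousOn_of_continuous hφc.continuousOn
      rw [ENNReal.tendsto_nhds_zero]
      intro η hη
      set c : ℝ≥0∞ := μ univ ^ (2 : ℝ≥0∞).toReal⁻¹ with hc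
      have hcfin : c ≠ ∞ := by
        refine ENNReal.rpow_ne_top_of_nonneg (by simp) ?_
        simp [hμ]
      obtain ⟨r, hr0, hr⟩ : ∃ r : ℝ, 0 < r ∧ c * ENNReal.ofReal r ≤ η := by
        have h1 : Tendsto (fun r : ℝ => c * ENNReal.ofReal r) (𝓝[>] 0) (𝓝 0) := by
          have h2 : Tendsto ENNReal.ofReal (𝓝[>] 0) (𝓝 0) := by
            simpa using (ENNReal.continuous_ofReal.tendsto 0).mono_left nhdsWithin_le_nhds
          simpa using ENNReal.Tendsto.const_mul h2 (Or.inr hcfin)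
        obtain ⟨r, h3, h4⟩ := ((h1.eventually (ge_mem_nhds hη)).and self_mem_nhdsWithin).exists
        exact ⟨r, h4, h3⟩
      obtain ⟨δ, hδ, hφδ⟩ := Metric.uniformContinuousOn_iff.1 huc r hr0
      have hsmall : Tendsto (fun n : ℕ => (T : ℝ) / ((n + 1 : ℕ) : ℝ)) atTop (𝓝 0) :=
        (tendsto_const_div_atTop_nhds_zero_nat (T : ℝ)).comp (tendsto_add_atTop_nat 1)
      filter_upwards [hsmall.eventually (gt_mem_nhds hδ)] with n hn
      refine (eLpNorm_le_of_ae_bound (C := r) ?_).trans hr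
      rw [hμ, ← restrict_Ioc_eq_restrict_Icc, ae_restrict_iff' measurableSet_Ioc]
      refine ae_of_all _ fun u hu => ?_
      obtain ⟨s, hs, hus, hval⟩ := exists_sample_eq hT φ n.succ_pos hu
      rw [hval, ← dist_eq_norm]
      refine (hφδ s hs u (Ioc_subset_Icc_self hu) ?_).le
      rw [dist_comm, Real.dist_eq]
      exact hus.trans_lt hn
    obtain ⟨n, hn⟩ := (hlim.eventually (gt_mem_nhds (ENNReal.half_pos hε.ne'))).exists
    refine ⟨sample T φ (n + 1), ?_⟩
    have e : (fun u => (sample T φ (n + 1)).toFun u - f u)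
        = (fun u => (sample T φ (n + 1)).toFun u - φ u) - (f - φ) := by
      ext u; simp
    have hφm : AEStronglyMeasurable φ μ := hφc.aestronglyMeasurable
    rw [e, ← ENNReal.add_halves ε]
    exact (eLpNorm_sub_le ((memLp_toFun _).aestronglyMeasurable.sub hφm)
      (hf.aestronglyMeasurable.sub hφm) (by norm_num)).trans (add_le_add hn.le hφ)
  choose g hg using fun n : ℕ => key (((n : ℝ≥0∞) + 1)⁻¹) (by simp)
  refine ⟨g, tendsto_of_tendsto_of_tendsto_of_le_of_le tendsto_const_nhds ?_ (fun _ => zero_le) hg⟩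
  have := ENNReal.tendsto_inv_nat_nhds_zero.comp (tendsto_add_atTop_nat 1)
  simpa [Function.comp_def] using this

end Step

/-! ### The stochastic integral -/

section StochIntegral

variable {P : Measure Ω} {B : ℝ≥0 → Ω → ℝ} {K : ℝ → ℝ} {T : ℝ≥0}

theorem IsGaussianNoise.memLp (hB : IsGaussianNoise P B) (t : ℝ≥0) : MemLp (B t) 2 P :=
  (hB.gaussian.hasGaussianLaw_eval t).memLp_two

theorem IsGaussianNoise.integrable_mul (hB : IsGaussianNoise P B) (t s : ℝ≥0) :
    Integrable (fun ω => B t ω * B s ω) P :=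
  (hB.memLp t).integrable_mul (hB.memLp s)

theorem IsGaussianNoise.memLp_integral (hB : IsGaussianNoise P B) (g : Step T) :
    MemLp (g.integral B) 2 P := by
  unfold Step.integral
  exact memLp_finsetSum _ fun i _ => ((hB.memLp _).sub (hB.memLp _)).const_mul _

/-- The covariance function is the double integral of `K (τ - u)`. The boundary values vanish
because `B_0 = 0`. -/
theorem integral_noise_mul (hB : IsGaussianNoise P B) (hK : HasCovKernel P B K) (t s : ℝ≥0) :
    ∫ ω, B t ω * B s ω ∂P = ∫ τ in (0 : ℝ)..t, kernelPrimitive K τ s := by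
  have h := hK.mixedDeriv.eq_integral (K := K) hK.integrable ?_ ?_ t.coe_nonneg s.coe_nonneg
  · simpa [covFun] using h
  · intro t
    refine integral_eq_zero_of_ae ?_
    filter_upwards [hB.zero] with ω hω
    simp [hω]
  · intro t
    refine integral_eq_zero_of_ae ?_
    filter_upwards [hB.zero] with ω hω
    simp [hω]

theorem integral_step_mul_noise (hB : IsGaussianNoise P B) (hK : HasCovKernel P B K)
    (g : Step T) (t : ℝ≥0) :
    ∫ ω, g.integral B ω * B t ω ∂P = ∫ τ in (0 : ℝ)..T, g.toFun τ * kernelPrimitive K τ t := by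
  have hc := continuous_kernelPrimitive hK.integrable (t : ℝ)
  rw [g.integral_toFun_mul (hc.intervalIntegrable _ _)]
  have e : ∀ ω, g.integral B ω * B t ω
      = ∑ i, g.coeff i * (B (g.right i) ω * B t ω - B (g.left i) ω * B t ω) := by
    intro ω
    rw [Step.integral, Finset.sum_mul]
    exact Finset.sum_congr rfl fun i _ => by ring
  simp only [e]
  rw [integral_finsetSum]
  · refine Finset.sum_congr rfl fun i _ => ?_
    rw [integral_const_mul, integral_sub (hB.integrable_mul _ _) (hB.integrable_mul _ _),
      integral_noise_mul hB hK, integral_noise_mul hB hK,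
      intervalIntegral.integral_interval_sub_left (hc.intervalIntegrable _ _)
        (hc.intervalIntegrable _ _)]
  · intro i _
    exact ((hB.integrable_mul _ _).sub (hB.integrable_mul _ _)).const_mul _

/-- The second moment of the elementary integral is the quadratic form of `Γ_T`. -/
theorem integral_step_sq (hB : IsGaussianNoise P B) (hK : HasCovKernel P B K) (g : Step T) :
    ∫ ω, g.integral B ω ^ 2 ∂P = ∫ τ in (0 : ℝ)..T, g.toFun τ * covOp K T g.toFun τ := by
  have hg : IntervalIntegrable g.toFun volume 0 T := by
    rw [intervalIntegrable_iff_integrableOn_Icc_of_le T.coe_nonneg]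
    exact g.memLp_toFun.integrable (by norm_num)
  have hgi : ∀ t : ℝ≥0, IntervalIntegrable
      (fun τ => g.toFun τ * kernelPrimitive K τ t) volume 0 T :=
    fun t => hg.mul_continuousOn (continuous_kernelPrimitive hK.integrable (t : ℝ)).continuousOn
  have hint : ∀ t : ℝ≥0, Integrable (fun ω => g.integral B ω * B t ω) P := fun t =>
    (hB.memLp_integral g).integrable_mul (hB.memLp t)
  have e : ∀ ω, g.integral B ω ^ 2
      = ∑ i, g.coeff i * (g.integral B ω * B (g.right i) ω - g.integral B ω * B (g.left i) ω) := by
    intro ω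
    rw [sq]
    nth_rewrite 2 [Step.integral]
    rw [Finset.mul_sum]
    exact Finset.sum_congr rfl fun i _ => by ring
  have e2 : ∀ τ, g.toFun τ * covOp K T g.toFun τ
      = ∑ i, g.coeff i * (g.toFun τ * kernelPrimitive K τ (g.right i)
          - g.toFun τ * kernelPrimitive K τ (g.left i)) := by
    intro τ
    have h1 : covOp K T g.toFun τ
        = ∑ i, g.coeff i * ∫ u in (g.left i : ℝ)..g.right i, K (τ - u) := by
      rw [← g.integral_toFun_mul, covOp]
      · exact intervalIntegral.integral_congr fun u _ => mul_comm _ _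
      · have := (intervalIntegrable_of_integrableOn_Icc hK.integrable (τ - 0) (τ - T)).comp_sub_left
          (c := τ)
        simpa using this
    rw [h1, Finset.mul_sum]
    refine Finset.sum_congr rfl fun i _ => ?_
    rw [← kernelPrimitive_sub hK.integrable]
    ring
  simp only [e, e2]
  rw [integral_finsetSum, intervalIntegral.integral_finsetSum]
  · refine Finset.sum_congr rfl fun i _ => ?_
    rw [integral_const_mul, integral_sub (hint _) (hint _), intervalIntegral.integral_const_mul,
      intervalIntegral.integral_sub (hgi _) (hgi _), integral_step_mul_noise hB hK,
      integral_step_mul_noise hB hK]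
  · intro i _
    exact ((hgi _).sub (hgi _)).const_mul _
  · intro i _
    exact ((hint _).sub (hint _)).const_mul _

/-- The elementary integral is bounded from `L²[0,T]` to `L²(P)`. -/
theorem exists_eLpNorm_step_le (hB : IsGaussianNoise P B) (hK : HasCovKernel P B K) (hT : 0 < T) :
    ∃ C : ℝ≥0∞, C ≠ ∞ ∧ ∀ g : Step T,
      eLpNorm (g.integral B) 2 P ≤ C * eLpNorm g.toFun 2 (volume.restrict (Icc (0 : ℝ) T)) := by
  set c : ℝ := ∫ t, ‖(Icc (-(T : ℝ)) T).indicator K t‖ with hc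
  have hc0 : 0 ≤ c := integral_nonneg fun _ => norm_nonneg _
  refine ⟨ENNReal.ofReal √c, ENNReal.ofReal_ne_top, fun g => ?_⟩
  rw [← ENNReal.pow_le_pow_left_iff two_ne_zero, mul_pow, ← ENNReal.ofReal_pow (Real.sqrt_nonneg _),
    Real.sq_sqrt hc0, ← ofReal_integral_sq_eq_eLpNorm_sq (hB.memLp_integral g),
    ← ofReal_integral_sq_eq_eLpNorm_sq g.memLp_toFun, ← ENNReal.ofReal_mul hc0,
    integral_step_sq hB hK]
  exact ENNReal.ofReal_le_ofReal (integral_mul_covOp_le hK.integrable hT g.memLp_toFun)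

theorem tendsto_eLpNorm_sub_trans {α : Type*} [MeasurableSpace α] {μ : Measure α}
    {X Y : ℕ → α → ℝ} {x : α → ℝ} (hX : ∀ n, MemLp (X n) 2 μ) (hY : ∀ n, MemLp (Y n) 2 μ)
    (hx : MemLp x 2 μ) (h : Tendsto (fun n => eLpNorm (fun a => X n a - Y n a) 2 μ) atTop (𝓝 0))
    (h' : Tendsto (fun n => eLpNorm (fun a => Y n a - x a) 2 μ) atTop (𝓝 0)) :
    Tendsto (fun n => eLpNorm (fun a => X n a - x a) 2 μ) atTop (𝓝 0) := by
  refine tendsto_of_tendsto_of_tendsto_of_le_of_le tendsto_const_nhds (by simpa using h.add h')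
    (fun _ => zero_le) fun n => ?_
  have e : (fun a => X n a - x a) = (fun a => X n a - Y n a) + fun a => Y n a - x a := by
    ext a; simp
  rw [e]
  exact eLpNorm_add_le ((hX n).sub (hY n)).aestronglyMeasurable
    ((hY n).sub hx).aestronglyMeasurable (by norm_num)

/-- Existence of `∫_0^T f dB` for `f ∈ L²[0,T]`. -/
theorem exists_isStochIntegral (hB : IsGaussianNoise P B) (hK : HasCovKernel P B K) (hT : 0 < T)
    {f : ℝ → ℝ} (hf : MemLp f 2 (volume.restrict (Icc (0 : ℝ) T))) :
    ∃ I : Ω → ℝ, Measurable I ∧ IsStochIntegral P B T f I := by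
  obtain ⟨C, hC, hbound⟩ := exists_eLpNorm_step_le hB hK hT
  obtain ⟨g, hg⟩ := Step.exists_tendsto hT hf
  have hstep : ∀ g g' : ℕ → Step T, Tendsto (fun n => eLpNorm (fun u => (g n).toFun u - f u) 2
      (volume.restrict (Icc (0 : ℝ) T))) atTop (𝓝 0) →
      Tendsto (fun n => eLpNorm (fun u => (g' n).toFun u - f u) 2
      (volume.restrict (Icc (0 : ℝ) T))) atTop (𝓝 0) →
      ∀ n m, eLpNorm (fun ω => (g n).integral B ω - (g' m).integral B ω) 2 P
        ≤ C * (eLpNorm (fun u => (g n).toFun u - f u) 2 (volume.restrict (Icc (0 : ℝ) T))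
          + eLpNorm (fun u => (g' m).toFun u - f u) 2 (volume.restrict (Icc (0 : ℝ) T))) := by
    intro g g' hg hg' n m
    have h1 := hbound ((g n).sub (g' m))
    have e1 : ((g n).sub (g' m)).integral B
        = fun ω => (g n).integral B ω - (g' m).integral B ω := by
      ext ω; exact Step.integral_sub _ _ _ _
    have e2 : ((g n).sub (g' m)).toFun
        = (fun u => (g n).toFun u - f u) - fun u => (g' m).toFun u - f u := by
      ext u; simp [Step.toFun_sub]
    rw [e1, e2] at h1
    refine h1.trans ?_
    gcongr
    exact eLpNorm_sub_le ((g n).memLp_toFun.sub hf).aestronglyMeasurable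
      ((g' m).memLp_toFun.sub hf).aestronglyMeasurable (by norm_num)
  have hcauchy : CauchySeq fun n => (hB.memLp_integral (g n)).toLp ((g n).integral B) := by
    refine EMetric.cauchySeq_iff.2 fun ε hε => ?_
    have hlim : Tendsto (fun n => C * eLpNorm (fun u => (g n).toFun u - f u) 2
        (volume.restrict (Icc (0 : ℝ) T))) atTop (𝓝 0) := by
      simpa using ENNReal.Tendsto.const_mul hg (Or.inr hC)
    obtain ⟨N, hN⟩ := eventually_atTop.1 (hlim.eventually (gt_mem_nhds (ENNReal.half_pos hε.ne')))
    refine ⟨N, fun n hn m hm => ?_⟩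
    rw [Lp.edist_toLp_toLp]
    refine (hstep g g hg hg n m).trans_lt ?_
    rw [mul_add, ← ENNReal.add_halves ε]
    exact ENNReal.add_lt_add (hN n hn) (hN m hm)
  obtain ⟨I, hI⟩ := cauchySeq_tendsto_of_complete hcauchy
  have hI2 : MemLp I 2 P := Lp.memLp I
  have hIg : Tendsto (fun n => eLpNorm (fun ω => (g n).integral B ω - I ω) 2 P) atTop (𝓝 0) :=
    (Lp.tendsto_Lp_iff_tendsto_eLpNorm'' (fun n => (g n).integral B)
      (fun n => hB.memLp_integral (g n)) I hI2).1 (by rwa [Lp.toLp_coeFn])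
  refine ⟨I, (Lp.stronglyMeasurable I).measurable, hI2, fun g' hg' => ?_⟩
  refine tendsto_eLpNorm_sub_trans (fun n => hB.memLp_integral (g' n))
    (fun n => hB.memLp_integral (g n)) hI2 ?_ hIg
  refine tendsto_of_tendsto_of_tendsto_of_le_of_le tendsto_const_nhds ?_
    (fun _ => zero_le) (fun n => hstep g' g hg' hg n n)
  simpa using ENNReal.Tendsto.const_mul (hg'.add hg) (Or.inr hC)

theorem IsStochIntegral.ae_eq (hB : IsGaussianNoise P B) (hT : 0 < T) {f : ℝ → ℝ}
    (hf : MemLp f 2 (volume.restrict (Icc (0 : ℝ) T))) {I J : Ω → ℝ}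
    (hI : IsStochIntegral P B T f I) (hJ : IsStochIntegral P B T f J) : I =ᵐ[P] J := by
  obtain ⟨g, hg⟩ := Step.exists_tendsto hT hf
  have h1 := (Lp.tendsto_Lp_iff_tendsto_eLpNorm'' (fun n => (g n).integral B)
    (fun n => hB.memLp_integral (g n)) I hI.1).2 (hI.2 g hg)
  have h2 := (Lp.tendsto_Lp_iff_tendsto_eLpNorm'' (fun n => (g n).integral B)
    (fun n => hB.memLp_integral (g n)) J hJ.1).2 (hJ.2 g hg)
  exact (MemLp.toLp_eq_toLp_iff _ _).1 (tendsto_nhds_unique h1 h2)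

theorem tendsto_integral_step {f : ℝ → ℝ} (hf : MemLp f 2 (volume.restrict (Icc (0 : ℝ) T)))
    {g : ℕ → Step T} (hg : Tendsto (fun n => eLpNorm (fun u => (g n).toFun u - f u) 2
      (volume.restrict (Icc (0 : ℝ) T))) atTop (𝓝 0)) {φ : ℝ → ℝ} (hφ : Continuous φ) :
    Tendsto (fun n => ∫ u in (0 : ℝ)..T, (g n).toFun u * φ u) atTop
      (𝓝 (∫ u in (0 : ℝ)..T, f u * φ u)) := by
  have hφ2 : MemLp φ 2 (volume.restrict (Icc (0 : ℝ) T)) := by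
    obtain ⟨C, hC⟩ := (isCompact_Icc (a := (0 : ℝ)) (b := T)).exists_bound_of_continuousOn
      hφ.continuousOn
    refine MemLp.of_bound hφ.aestronglyMeasurable C ?_
    exact (ae_restrict_iff' measurableSet_Icc).2 (ae_of_all _ hC)
  simpa only [intervalIntegral.integral_of_le T.coe_nonneg, integral_Icc_eq_integral_Ioc] using
    tendsto_integral_mul_const_of_tendsto_eLpNorm (fun n => (g n).memLp_toFun) hf hφ2 hg

/-- Since `X_t = θ t + B_t`, the integrals against `X` and `B` differ by `θ ∫ f`. -/
theorem isStochIntegral_observed_iff [IsProbabilityMeasure P] (hB : IsGaussianNoise P B) {f : ℝ → ℝ}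
    (hf : MemLp f 2 (volume.restrict (Icc (0 : ℝ) T))) (θ : ℝ) {I : Ω → ℝ} :
    IsStochIntegral P (observed θ B) T f I ↔
      IsStochIntegral P B T f (fun ω => I ω - θ * ∫ u in (0 : ℝ)..T, f u) := by
  set c := ∫ u in (0 : ℝ)..T, f u with hc
  have hX : ∀ g : Step T, g.integral (observed θ B)
      = fun ω => θ * (∫ u in (0 : ℝ)..T, g.toFun u) + g.integral B ω := by
    intro g; ext ω; exact g.integral_observed θ B ω
  have hX2 : ∀ g : Step T, MemLp (g.integral (observed θ B)) 2 P := fun g => by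
    rw [hX]; exact (memLp_const (θ * (∫ u in (0 : ℝ)..T, g.toFun u))).add (hB.memLp_integral g)
  have hconst : ∀ g : ℕ → Step T, Tendsto (fun n => eLpNorm (fun u => (g n).toFun u - f u) 2
      (volume.restrict (Icc (0 : ℝ) T))) atTop (𝓝 0) →
      Tendsto (fun n => eLpNorm (fun _ : Ω => θ * (∫ u in (0 : ℝ)..T, (g n).toFun u) - θ * c) 2 P)
        atTop (𝓝 0) := by
    intro g hg
    have h1 := tendsto_integral_step hf hg (continuous_const (y := (1 : ℝ)))
    simp only [mul_one] at h1
    have h2 := ((h1.const_mul θ).sub_const (θ * c)).enorm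
    have e : ∀ x : ℝ, eLpNorm (fun _ : Ω => x) 2 P = ‖x‖ₑ := fun x => by
      rw [eLpNorm_const _ (by norm_num) (IsProbabilityMeasure.ne_zero P)]
      simp
    simp only [e]
    simpa [hc] using h2
  constructor
  · rintro ⟨hI, hlim⟩
    have hI' : MemLp (fun ω => I ω - θ * c) 2 P := hI.sub (memLp_const (θ * c))
    refine ⟨hI', fun g hg => ?_⟩
    refine tendsto_eLpNorm_sub_trans (Y := fun n ω => (g n).integral (observed θ B) ω - θ * c)
      (fun n => hB.memLp_integral (g n)) (fun n => (hX2 (g n)).sub (memLp_const (θ * c))) hI' ?_ ?_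
    · refine (hconst g hg).congr fun n => ?_
      rw [← eLpNorm_neg]
      congr 1
      ext ω
      simp only [hX, Pi.neg_apply]
      ring
    · simpa using hlim g hg
  · rintro ⟨hI', hlim⟩
    have hI : MemLp I 2 P := by
      have h := hI'.add (memLp_const (θ * c))
      have e : (fun ω => I ω - θ * c) + (fun _ => θ * c) = I := by ext ω; simp
      rwa [e] at h
    refine ⟨hI, fun g hg => ?_⟩
    refine tendsto_eLpNorm_sub_trans (Y := fun n ω => (g n).integral B ω + θ * c)
      (fun n => hX2 (g n)) (fun n => (hB.memLp_integral (g n)).add (memLp_const (θ * c))) hI ?_ ?_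
    · refine (hconst g hg).congr fun n => ?_
      congr 1
      ext ω
      simp only [hX]
      ring
    · refine (hlim g hg).congr fun n => ?_
      congr 1
      ext ω
      ring

theorem IsStochIntegral.integral_mul_noise (hB : IsGaussianNoise P B) (hK : HasCovKernel P B K)
    (hT : 0 < T) {f : ℝ → ℝ} (hf : MemLp f 2 (volume.restrict (Icc (0 : ℝ) T))) {I : Ω → ℝ}
    (hI : IsStochIntegral P B T f I) {t : ℝ≥0} (ht : t ≤ T) :
    ∫ ω, I ω * B t ω ∂P = ∫ u in (0 : ℝ)..t, covOp K T f u := by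
  obtain ⟨g, hg⟩ := Step.exists_tendsto hT hf
  have h1 := tendsto_integral_mul_const_of_tendsto_eLpNorm (fun n => hB.memLp_integral (g n)) hI.1
    (hB.memLp t) (hI.2 g hg)
  have h2 := tendsto_integral_step hf hg (continuous_kernelPrimitive hK.integrable (t : ℝ))
  simp only [integral_step_mul_noise hB hK] at h1
  rw [tendsto_nhds_unique h1 h2, integral_mul_kernelPrimitive hK.integrable hK.even hT
    (hf.integrable (by norm_num)) ⟨t.coe_nonneg, by exact_mod_cast ht⟩]

/-- The integral `M_T = ∫ h_T dB` represents the drift: `E M_T B_t = t` for `t ≤ T`. -/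
theorem IsStochIntegral.integral_mul_noise_of_solvesOne (hB : IsGaussianNoise P B)
    (hK : HasCovKernel P B K) (hT : 0 < T) {f : ℝ → ℝ} (hf : SolvesOne K T f) {I : Ω → ℝ}
    (hI : IsStochIntegral P B T f I) {t : ℝ≥0} (ht : t ≤ T) :
    ∫ ω, I ω * B t ω ∂P = t := by
  rw [hI.integral_mul_noise hB hK hT hf.1 ht]
  have : ∫ u in (0 : ℝ)..t, covOp K T f u = ∫ u in (0 : ℝ)..t, (1 : ℝ) := by
    refine intervalIntegral.integral_congr_ae ?_
    have h := hf.2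
    rw [ae_restrict_iff' measurableSet_Icc] at h
    filter_upwards [h] with u hu hu'
    rw [uIoc_of_le t.coe_nonneg] at hu'
    exact hu ⟨hu'.1.le, hu'.2.trans (by exact_mod_cast ht)⟩
  rw [this]
  simp

/-- The integral `M_T = ∫ h_T dB` represents integration against Lebesgue measure:
`E (M_T ∫_0^S f dB) = ∫_0^S f` for `S ≤ T`. -/
theorem IsStochIntegral.integral_mul_of_solvesOne (hB : IsGaussianNoise P B)
    (hK : HasCovKernel P B K) (hT : 0 < T) {h f : ℝ → ℝ} (hh : SolvesOne K T h) {I J : Ω → ℝ}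
    (hI : IsStochIntegral P B T h I) {S : ℝ≥0} (hS : 0 < S) (hST : S ≤ T)
    (hf : MemLp f 2 (volume.restrict (Icc (0 : ℝ) S))) (hJ : IsStochIntegral P B S f J) :
    ∫ ω, I ω * J ω ∂P = ∫ u in (0 : ℝ)..S, f u := by
  obtain ⟨g, hg⟩ := Step.exists_tendsto hS hf
  have h1 := tendsto_integral_mul_const_of_tendsto_eLpNorm (fun n => hB.memLp_integral (g n)) hJ.1
    hI.1 (hJ.2 g hg)
  have h2 := tendsto_integral_step hf hg (continuous_const (y := (1 : ℝ)))
  have e : ∀ g : Step S, ∫ ω, g.integral B ω * I ω ∂P = ∫ u in (0 : ℝ)..S, g.toFun u * 1 := by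
    intro g
    have hint : ∀ t : ℝ≥0, Integrable (fun ω => I ω * B t ω) P := fun t =>
      hI.1.integrable_mul (hB.memLp t)
    have e1 : ∀ ω, g.integral B ω * I ω
        = ∑ i, g.coeff i * (I ω * B (g.right i) ω - I ω * B (g.left i) ω) := by
      intro ω
      rw [Step.integral, Finset.sum_mul]
      exact Finset.sum_congr rfl fun i _ => by ring
    simp only [e1, mul_one]
    rw [g.integral_toFun, integral_finsetSum]
    · refine Finset.sum_congr rfl fun i _ => ?_
      rw [integral_const_mul, integral_sub (hint _) (hint _),
        hI.integral_mul_noise_of_solvesOne hB hK hT hh ((g.right_le i).trans hST),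
        hI.integral_mul_noise_of_solvesOne hB hK hT hh
          (((g.left_le_right i).trans (g.right_le i)).trans hST)]
    · intro i _
      exact ((hint _).sub (hint _)).const_mul _
  simp only [e] at h1
  have := tendsto_nhds_unique h1 h2
  simp only [mul_one] at this
  rw [← this]
  exact integral_congr_ae (ae_of_all _ fun ω => mul_comm _ _)

theorem IsStochIntegral.integral_eq_zero [IsProbabilityMeasure P] (hB : IsGaussianNoise P B)
    (hT : 0 < T) {f : ℝ → ℝ}
    (hf : MemLp f 2 (volume.restrict (Icc (0 : ℝ) T))) {I : Ω → ℝ}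
    (hI : IsStochIntegral P B T f I) : ∫ ω, I ω ∂P = 0 := by
  obtain ⟨g, hg⟩ := Step.exists_tendsto hT hf
  have h1 := tendsto_integral_mul_const_of_tendsto_eLpNorm (fun n => hB.memLp_integral (g n)) hI.1
    (memLp_const (1 : ℝ)) (hI.2 g hg)
  have e : ∀ g : Step T, ∫ ω, g.integral B ω * 1 ∂P = 0 := by
    intro g
    have hint : ∀ t : ℝ≥0, Integrable (B t) P := fun t => (hB.memLp t).integrable (by norm_num)
    simp only [mul_one, Step.integral]
    rw [integral_finsetSum]
    · refine Finset.sum_eq_zero fun i _ => ?_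
      rw [integral_const_mul, integral_sub (hint _) (hint _), hB.centered, hB.centered]
      simp
    · intro i _
      exact ((hint _).sub (hint _)).const_mul _
  simp only [e] at h1
  simp only [mul_one] at h1
  exact (tendsto_nhds_unique h1 tendsto_const_nhds)

/-- Stochastic integrals against `B` are jointly Gaussian, together with `B`. -/
theorem isGaussianProcess_sumElim [IsProbabilityMeasure P] (hB : IsGaussianNoise P B) {ι : Type*}
    {S : ι → ℝ≥0}
    (hS : ∀ i, 0 < S i) {f : ι → ℝ → ℝ}
    (hf : ∀ i, MemLp (f i) 2 (volume.restrict (Icc (0 : ℝ) (S i)))) {I : ι → Ω → ℝ}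
    (hI : ∀ i, IsStochIntegral P B (S i) (f i) (I i)) :
    IsGaussianProcess (Sum.elim B I) P := by
  classical
  choose g hg using fun i => Step.exists_tendsto (hS i) (hf i)
  refine isGaussianProcess_of_tendsto_eLpNorm
    (G := fun n => Sum.elim B fun i => (g i n).integral B) (fun n => ?_) ?_ ?_
  · refine hB.gaussian.of_isGaussianProcess fun s => ?_
    rcases s with t | i
    · exact ⟨{t}, ContinuousLinearMap.proj (⟨t, by simp⟩ : ({t} : Finset ℝ≥0)), fun ω => rfl⟩
    · let A : Finset ℝ≥0 := Finset.univ.image (g i n).left ∪ Finset.univ.image (g i n).right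
      have hl : ∀ j, (g i n).left j ∈ A := fun j => by simp [A]
      have hr : ∀ j, (g i n).right j ∈ A := fun j => by simp [A]
      refine ⟨A, ∑ j, (g i n).coeff j • (ContinuousLinearMap.proj ⟨(g i n).right j, hr j⟩
        - ContinuousLinearMap.proj ⟨(g i n).left j, hl j⟩), fun ω => ?_⟩
      simp [Step.integral]
  · rintro (t | i)
    · exact hB.memLp t
    · exact (hI i).1
  · rintro (t | i)
    · simp
    · exact (hI i).2 _ (hg i)

end StochIntegral

/-! ### Growth of the variance -/

section Growth

variable {P : Measure Ω} {B : ℝ≥0 → Ω → ℝ} {K : ℝ → ℝ}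

/-- Stationarity: the covariance of unit increments starting at `j + n` and `j` does not depend on
`j`. -/
theorem IsGaussianNoise.integral_increments (hB : IsGaussianNoise P B) (j n : ℕ) :
    ∫ ω, (B ((j : ℝ≥0) + n + 1) ω - B ((j : ℝ≥0) + n) ω) * (B ((j : ℝ≥0) + 1) ω - B j ω) ∂P
      = ∫ ω, (B ((n : ℝ≥0) + 1) ω - B (n : ℝ≥0) ω) * B 1 ω ∂P := by
  have hφ : Measurable fun x : ℝ≥0 → ℝ => (x ((n : ℝ≥0) + 1) - x n) * x 1 := by fun_prop
  have h1 : Measurable (fun ω (t : ℝ≥0) => B ((j : ℝ≥0) + t) ω - B j ω) :=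
    measurable_pi_lambda _ fun t => (hB.measurable _).sub (hB.measurable _)
  have h2 : Measurable (fun ω (t : ℝ≥0) => B t ω - B 0 ω) :=
    measurable_pi_lambda _ fun t => (hB.measurable _).sub (hB.measurable _)
  have e1 := integral_map (μ := P) h1.aemeasurable
    (f := fun x : ℝ≥0 → ℝ => (x ((n : ℝ≥0) + 1) - x n) * x 1) hφ.aestronglyMeasurable
  have e2 := integral_map (μ := P) h2.aemeasurable
    (f := fun x : ℝ≥0 → ℝ => (x ((n : ℝ≥0) + 1) - x n) * x 1) hφ.aestronglyMeasurable
  rw [hB.stationary, e2] at e1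
  calc _ = ∫ ω, (B ((j : ℝ≥0) + ((n : ℝ≥0) + 1)) ω - B j ω - (B ((j : ℝ≥0) + n) ω - B j ω))
        * (B ((j : ℝ≥0) + 1) ω - B j ω) ∂P := by
        refine integral_congr_ae (ae_of_all _ fun ω => ?_)
        simp only [add_assoc]
        ring
    _ = _ := e1.symm
    _ = _ := by
        refine integral_congr_ae ?_
        filter_upwards [hB.zero] with ω hω
        simp [hω]

/-- With `r n = E (B_{n+1} - B_n) B_1`, the covariance of two unit increments at distance `n`, the
variance of `B_N` is at most `2 N ∑_{n<N} |r n|`. -/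
theorem IsGaussianNoise.integral_sq_le (hB : IsGaussianNoise P B) (N : ℕ) :
    ∫ ω, B (N : ℝ≥0) ω ^ 2 ∂P ≤ 2 * N * ∑ n ∈ Finset.range N,
      |∫ ω, (B ((n : ℝ≥0) + 1) ω - B (n : ℝ≥0) ω) * B 1 ω ∂P| := by
  set r : ℕ → ℝ := fun n => ∫ ω, (B ((n : ℝ≥0) + 1) ω - B (n : ℝ≥0) ω) * B 1 ω ∂P with hr
  have hmem : ∀ N : ℕ, MemLp (fun ω => B ((N : ℝ≥0) + 1) ω - B (N : ℝ≥0) ω) 2 P :=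
    fun N => (hB.memLp _).sub (hB.memLp _)
  have hcross : ∀ N m : ℕ, m ≤ N →
      ∫ ω, (B ((N : ℝ≥0) + 1) ω - B (N : ℝ≥0) ω) * B (m : ℝ≥0) ω ∂P
        = ∑ j ∈ Finset.range m, r (N - j) := by
    intro N m
    induction m with
    | zero =>
      intro _
      rw [Finset.range_zero, Finset.sum_empty]
      refine integral_eq_zero_of_ae ?_
      filter_upwards [hB.zero] with ω hω
      simp [hω]
    | succ m ih =>
      intro hm
      rw [Finset.sum_range_succ, ← ih (by omega)]
      have h1 := hB.integral_increments m (N - m)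
      have e : (m : ℝ≥0) + ((N - m : ℕ) : ℝ≥0) = N := by
        have : m + (N - m) = N := by omega
        exact_mod_cast congrArg (Nat.cast : ℕ → ℝ≥0) this
      rw [e] at h1
      have h2 : r (N - m) = _ := h1.symm
      rw [h2, ← integral_add]
      · refine integral_congr_ae (ae_of_all _ fun ω => ?_)
        push_cast
        ring
      · exact (hmem N).integrable_mul (hB.memLp _)
      · exact (hmem N).integrable_mul (hmem m)
  induction N with
  | zero =>
    refine (integral_eq_zero_of_ae ?_).trans_le (by simp)
    filter_upwards [hB.zero] with ω hω
    simp [hω]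
  | succ N ih =>
    have hstep : ∫ ω, B ((N + 1 : ℕ) : ℝ≥0) ω ^ 2 ∂P = ∫ ω, B (N : ℝ≥0) ω ^ 2 ∂P
        + 2 * (∑ j ∈ Finset.range N, r (N - j)) + r 0 := by
      have h0 := hB.integral_increments N 0
      have h0' : r 0 = _ := h0.symm
      rw [← hcross N N le_rfl, h0', ← integral_const_mul, ← integral_add, ← integral_add]
      · refine integral_congr_ae (ae_of_all _ fun ω => ?_)
        push_cast
        simp only [add_zero]
        ring
      · exact (hB.memLp _).integrable_sq.add (((hmem N).integrable_mul (hB.memLp _)).const_mul 2)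
      · simp only [Nat.cast_zero, add_zero]
        exact (hmem N).integrable_mul (hmem N)
      · exact (hB.memLp _).integrable_sq
      · exact ((hmem N).integrable_mul (hB.memLp _)).const_mul 2
    rw [hstep]
    have hA : ∑ j ∈ Finset.range N, r (N - j) + r 0 ≤ ∑ n ∈ Finset.range (N + 1), |r n| := by
      have h3 : ∑ j ∈ Finset.range N, r (N - j) + r 0
          = ∑ j ∈ Finset.range (N + 1), r (N + 1 - 1 - j) := by
        rw [Finset.sum_range_succ]; simp
      rw [h3, Finset.sum_range_reflect]
      exact Finset.sum_le_sum fun n _ => le_abs_self _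
    have hA' : ∑ j ∈ Finset.range N, r (N - j) ≤ ∑ n ∈ Finset.range (N + 1), |r n| := by
      have h3 : ∑ j ∈ Finset.range N, r (N - j) = ∑ j ∈ Finset.range N, r (j + 1) := by
        rw [← Finset.sum_range_reflect]
        refine Finset.sum_congr rfl fun j hj => ?_
        congr 1
        have := Finset.mem_range.1 hj
        omega
      rw [h3, Finset.sum_range_succ']
      have := Finset.sum_le_sum fun n (_ : n ∈ Finset.range N) => le_abs_self (r (n + 1))
      have := abs_nonneg (r 0)
      linarith
    have hmono : ∑ n ∈ Finset.range N, |r n| ≤ ∑ n ∈ Finset.range (N + 1), |r n| := by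
      rw [Finset.sum_range_succ]; linarith [abs_nonneg (r N)]
    have h4 : 2 * (N : ℝ) * ∑ n ∈ Finset.range N, |r n|
        ≤ 2 * (N : ℝ) * ∑ n ∈ Finset.range (N + 1), |r n| :=
      mul_le_mul_of_nonneg_left hmono (by positivity)
    push_cast
    linarith

end Growth

/-! ### The estimation error as a reversed Gaussian martingale -/

/-- `Y = (Y_t)_{t > 0}` is a centered Gaussian process with covariance
`E Y_s Y_t = w (max s t)`: in reversed time it is a Gaussian process with independent
increments. -/
structure IsReversedGaussianMartingale (P : Measure Ω) (Y : ℝ≥0 → Ω → ℝ) (w : ℝ≥0 → ℝ) : Prop where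
  measurable : ∀ t, Measurable (Y t)
  gaussian : IsGaussianProcess (fun t : Ioi (0 : ℝ≥0) => Y t) P
  centered : ∀ t, 0 < t → ∫ ω, Y t ω ∂P = 0
  cov : ∀ s t, 0 < s → s ≤ t → ∫ ω, Y t ω * Y s ω ∂P = w t

namespace IsReversedGaussianMartingale

variable {P : Measure Ω} [IsProbabilityMeasure P] {Y : ℝ≥0 → Ω → ℝ} {w : ℝ≥0 → ℝ}

/-- The maximal inequality, applied to the martingale obtained by running through `F` backwards down
to time `a`. -/
theorem measure_exists_mem_finset_le (hY : IsReversedGaussianMartingale P Y w) {a : ℝ≥0}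
    (ha : 0 < a) (F : Finset ℝ≥0) (hF : ∀ s ∈ F, a ≤ s) {ε : ℝ} (hε : 0 < ε) :
    P {ω | ∃ s ∈ F, ε ≤ |Y s ω|} ≤ ENNReal.ofReal (√(w a) / ε) := by
  -- the points of `F` in decreasing order, followed by `a`
  set l := F.sort (· ≥ ·) with hl
  let t : ℕ → ℝ≥0 := fun k => l.getD k a
  have hmem : ∀ k (hk : k < l.length), l[k] ∈ F := fun k hk =>
    (Finset.mem_sort _).1 (List.getElem_mem hk)
  have hta : ∀ k, a ≤ t k := by
    intro k
    by_cases hk : k < l.length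
    · simp only [t, List.getD_eq_getElem _ _ hk]
      exact hF _ (hmem k hk)
    · simp only [t, List.getD_eq_default _ _ (not_lt.1 hk)]
      exact le_rfl
  have hanti : ∀ i j, i ≤ j → t j ≤ t i := by
    intro i j hij
    by_cases hj : j < l.length
    · have hi : i < l.length := hij.trans_lt hj
      simp only [t, List.getD_eq_getElem _ _ hj, List.getD_eq_getElem _ _ hi]
      rcases hij.eq_or_lt with rfl | hlt
      · exact le_rfl
      · exact List.pairwise_iff_getElem.1 (Finset.pairwise_sort F (· ≥ ·)) i j hi hj hlt
    · simp only [t, List.getD_eq_default _ _ (not_lt.1 hj)]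
      exact hta i
  have htl : t l.length = a := List.getD_eq_default _ _ le_rfl
  have hpos : ∀ k, 0 < t k := fun k => ha.trans_le (hta k)
  have hG : IsGaussianProcess (fun k => Y (t k)) P :=
    hY.gaussian.comp_right fun k => (⟨t k, hpos k⟩ : Ioi (0 : ℝ≥0))
  have h := measure_exists_le_abs_le hG (fun k => hY.measurable _) (fun k => hY.centered _ (hpos k))
    (fun j k hjk => by
      have e : ∀ i, j ≤ i → ∫ ω, Y (t i) ω * Y (t j) ω ∂P = w (t j) := fun i hi => by
        rw [← hY.cov _ _ (hpos i) (hanti j i hi)]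
        exact integral_congr_ae (ae_of_all _ fun ω => mul_comm _ _)
      rw [e _ (by omega), e _ hjk]) l.length hε
  have hsq : ∫ ω, Y (t l.length) ω ^ 2 ∂P = w a := by
    simp only [htl, sq]
    exact hY.cov a a ha le_rfl
  rw [hsq] at h
  refine (measure_mono ?_).trans h
  rintro ω ⟨s, hs, hsε⟩
  obtain ⟨k, hk, hks⟩ := List.getElem_of_mem ((Finset.mem_sort (· ≥ ·)).2 hs)
  refine ⟨k, le_of_lt hk, ?_⟩
  have : t k = s := by
    simp only [t]
    rw [List.getD_eq_getElem _ _ hk]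
    exact hks
  rw [this]
  exact hsε

theorem measure_exists_mem_countable_le (hY : IsReversedGaussianMartingale P Y w) {a : ℝ≥0}
    (ha : 0 < a) {D : Set ℝ≥0} (hD : D.Countable) (hDa : ∀ s ∈ D, a ≤ s) {ε : ℝ} (hε : 0 < ε) :
    P {ω | ∃ s ∈ D, ε ≤ |Y s ω|} ≤ ENNReal.ofReal (√(w a) / ε) := by
  rcases D.eq_empty_or_nonempty with rfl | hne
  · simp
  obtain ⟨e, rfl⟩ := hD.exists_eq_range hne
  have hset : {ω | ∃ s ∈ range e, ε ≤ |Y s ω|}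
      = ⋃ n : ℕ, {ω | ∃ s ∈ (Finset.range n).image e, ε ≤ |Y s ω|} := by
    ext ω
    simp only [mem_ofPred_eq, mem_iUnion, Finset.mem_image, Finset.mem_range, mem_range]
    constructor
    · rintro ⟨_, ⟨k, rfl⟩, h⟩
      exact ⟨k + 1, _, ⟨k, by omega, rfl⟩, h⟩
    · rintro ⟨n, _, ⟨k, -, rfl⟩, h⟩
      exact ⟨_, ⟨k, rfl⟩, h⟩
  have hmono : Monotone fun n : ℕ => {ω | ∃ s ∈ (Finset.range n).image e, ε ≤ |Y s ω|} := by
    rintro n m hnm ω ⟨s, hs, h⟩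
    refine ⟨s, ?_, h⟩
    exact Finset.image_subset_image (Finset.range_mono hnm) hs
  rw [hset, hmono.measure_iUnion]
  refine iSup_le fun n => hY.measure_exists_mem_finset_le ha _ ?_ hε
  intro s hs
  obtain ⟨k, -, rfl⟩ := Finset.mem_image.1 hs
  exact hDa _ ⟨k, rfl⟩

/-- The strong law of large numbers along a countable set of times. -/
theorem ae_tendsto_zero (hY : IsReversedGaussianMartingale P Y w) (hw : Tendsto w atTop (𝓝 0))
    {D : Set ℝ≥0} (hD : D.Countable) :
    ∀ᵐ ω ∂P, Tendsto (fun t => Y t ω) (atTop ⊓ 𝓟 D) (𝓝 0) := by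
  have key : ∀ m : ℕ, ∀ᵐ ω ∂P, ∃ n : ℕ, ∀ s ∈ D, (n : ℝ≥0) ≤ s → |Y s ω| < 1 / ((m : ℝ) + 1) := by
    intro m
    have hm : (0 : ℝ) < 1 / ((m : ℝ) + 1) := by positivity
    have hlim : Tendsto (fun n : ℕ =>
        ENNReal.ofReal (√(w ((n + 1 : ℕ) : ℝ≥0)) / (1 / ((m : ℝ) + 1))))
        atTop (𝓝 0) := by
      have h1 : Tendsto (fun n : ℕ => w ((n + 1 : ℕ) : ℝ≥0)) atTop (𝓝 0) :=
        hw.comp (tendsto_natCast_atTop_atTop.comp (tendsto_add_atTop_nat 1))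
      have h2 := ENNReal.tendsto_ofReal (h1.sqrt.div_const (1 / ((m : ℝ) + 1)))
      simpa using h2
    have hbound : ∀ n : ℕ, P {ω | ¬ ∃ n : ℕ, ∀ s ∈ D, (n : ℝ≥0) ≤ s → |Y s ω| < 1 / ((m : ℝ) + 1)}
        ≤ ENNReal.ofReal (√(w ((n + 1 : ℕ) : ℝ≥0)) / (1 / ((m : ℝ) + 1))) := by
      intro n
      refine (measure_mono ?_).trans (hY.measure_exists_mem_countable_le
        (a := ((n + 1 : ℕ) : ℝ≥0)) (by exact_mod_cast n.succ_pos)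
        (D := D ∩ Ici ((n + 1 : ℕ) : ℝ≥0)) (hD.mono inter_subset_left) (fun s hs => hs.2) hm)
      intro ω hω
      simp only [mem_ofPred_eq, not_exists, not_forall, not_lt] at hω
      obtain ⟨s, hs, hns, h⟩ := hω (n + 1)
      exact ⟨s, ⟨hs, hns⟩, h⟩
    exact le_antisymm (ge_of_tendsto' hlim hbound) (zero_le)
  filter_upwards [ae_all_iff.2 key] with ω hω
  rw [Metric.tendsto_nhds]
  intro ε hε
  obtain ⟨m, hm⟩ := exists_nat_one_div_lt hε
  obtain ⟨n, hn⟩ := hω m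
  rw [eventually_inf_principal]
  filter_upwards [eventually_ge_atTop (n : ℝ≥0)] with s hs hsD
  rw [Real.dist_eq, sub_zero]
  exact (hn s hsD hs).trans hm

/-- Over a countable set of times, almost every path is bounded on `[a, ∞)` for every `a > 0`. -/
theorem ae_bounded (hY : IsReversedGaussianMartingale P Y w) {D : Set ℝ≥0} (hD : D.Countable) :
    ∀ᵐ ω ∂P, ∀ a : ℝ≥0, 0 < a → ∃ C : ℝ, ∀ s ∈ D, a ≤ s → |Y s ω| ≤ C := by
  have key : ∀ k : ℕ, ∀ᵐ ω ∂P, ∃ m : ℕ, ∀ s ∈ D,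
      1 / ((k : ℝ≥0) + 1) ≤ s → |Y s ω| < (m : ℝ) + 1 := by
    intro k
    set a : ℝ≥0 := 1 / ((k : ℝ≥0) + 1) with ha
    have ha0 : 0 < a := by positivity
    have hlim : Tendsto (fun m : ℕ => ENNReal.ofReal (√(w a) / ((m : ℝ) + 1))) atTop (𝓝 0) := by
      have h1 : Tendsto (fun m : ℕ => √(w a) / ((m : ℝ) + 1)) atTop (𝓝 0) :=
        tendsto_const_nhds.div_atTop
          (tendsto_atTop_add_const_right _ _ tendsto_natCast_atTop_atTop)
      simpa using ENNReal.tendsto_ofReal h1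
    have hbound : ∀ m : ℕ, P {ω | ¬ ∃ m : ℕ, ∀ s ∈ D, a ≤ s → |Y s ω| < (m : ℝ) + 1}
        ≤ ENNReal.ofReal (√(w a) / ((m : ℝ) + 1)) := by
      intro m
      refine (measure_mono ?_).trans (hY.measure_exists_mem_countable_le ha0
        (D := D ∩ Ici a) (hD.mono inter_subset_left) (fun s hs => hs.2) (by positivity))
      intro ω hω
      simp only [mem_ofPred_eq, not_exists, not_forall, not_lt] at hω
      obtain ⟨s, hs, has, h⟩ := hω m
      exact ⟨s, ⟨hs, has⟩, h⟩
    exact le_antisymm (ge_of_tendsto' hlim hbound) (zero_le)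
  filter_upwards [ae_all_iff.2 key] with ω hω a ha
  obtain ⟨k, hk⟩ := exists_nat_one_div_lt (K := ℝ) (NNReal.coe_pos.2 ha)
  obtain ⟨m, hm⟩ := hω k
  refine ⟨(m : ℝ) + 1, fun s hs has => (hm s hs ?_).le⟩
  have : (1 / ((k : ℝ≥0) + 1)) ≤ a := by
    rw [← NNReal.coe_le_coe]; push_cast; exact hk.le
  exact this.trans has

end IsReversedGaussianMartingale

/-! ### Separability -/

section Separable

variable {P : Measure Ω}

/-- A separable process converges at infinity as soon as it does so along countable sets. -/
theorem IsSeparableProcess.ae_tendsto {Y : ℝ≥0 → Ω → ℝ} (hY : IsSeparableProcess P Y) {c : ℝ}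
    (h : ∀ D : Set ℝ≥0, D.Countable → ∀ᵐ ω ∂P, Tendsto (fun t => Y t ω) (atTop ⊓ 𝓟 D) (𝓝 c)) :
    ∀ᵐ ω ∂P, Tendsto (fun t => Y t ω) atTop (𝓝 c) := by
  obtain ⟨S, -, hS, hcl⟩ := hY
  filter_upwards [h S hS, hcl] with ω hlim hω
  rw [Metric.tendsto_nhds] at hlim ⊢
  intro ε hε
  have h1 := hlim (ε / 2) (half_pos hε)
  rw [eventually_inf_principal] at h1
  obtain ⟨N, hN⟩ := eventually_atTop.1 h1
  filter_upwards [eventually_gt_atTop N] with t ht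
  have hclosed : IsClosed {p : ℝ≥0 × ℝ | p.1 ≤ N ∨ dist p.2 c ≤ ε / 2} :=
    (isClosed_le continuous_fst continuous_const).union
      (isClosed_le (continuous_snd.dist continuous_const) continuous_const)
  have hsub : (fun s => (s, Y s ω)) '' S ⊆ {p : ℝ≥0 × ℝ | p.1 ≤ N ∨ dist p.2 c ≤ ε / 2} := by
    rintro _ ⟨s, hs, rfl⟩
    rcases le_total s N with h2 | h2
    · exact Or.inl h2
    · exact Or.inr (hN s h2 hs).le
  have h3 := closure_minimal hsub hclosed (hω t (pos_of_gt ht))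
  rcases h3 with h3 | h3
  · exact absurd h3 (not_le.2 ht)
  · exact lt_of_le_of_lt h3 (half_lt_self hε)

theorem IsSeparableProcess.const_add {Y : ℝ≥0 → Ω → ℝ} (hY : IsSeparableProcess P Y) (c : ℝ) :
    IsSeparableProcess P (fun t ω => c + Y t ω) := by
  obtain ⟨S, hS0, hS, hcl⟩ := hY
  refine ⟨S, hS0, hS, ?_⟩
  filter_upwards [hcl] with ω hω t ht
  refine map_mem_closure (f := fun p : ℝ≥0 × ℝ => (p.1, c + p.2)) (by fun_prop) (hω t ht) ?_
  rintro _ ⟨s, hs, rfl⟩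
  exact ⟨s, hs, rfl⟩

/-- Doob's construction of a separable version: where the point `(t, Y_t)` is not a limit of points
of the graph over `S`, the value `Y_t` is replaced by some limit value. -/
theorem exists_isSeparableProcess {Y : ℝ≥0 → Ω → ℝ} {S : Set ℝ≥0} (hS0 : S ⊆ Ioi 0)
    (hS : S.Countable)
    (h1 : ∀ t : ℝ≥0, 0 < t → ∀ᵐ ω ∂P, (t, Y t ω) ∈ closure ((fun s => (s, Y s ω)) '' S))
    (h2 : ∀ᵐ ω ∂P, ∀ t : ℝ≥0, 0 < t → ∃ x, (t, x) ∈ closure ((fun s => (s, Y s ω)) '' S)) :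
    ∃ Y' : ℝ≥0 → Ω → ℝ, (∀ t, 0 < t → Y' t =ᵐ[P] Y t) ∧ IsSeparableProcess P Y' := by
  classical
  let Y' : ℝ≥0 → Ω → ℝ := fun t ω =>
    if (t, Y t ω) ∈ closure ((fun s => (s, Y s ω)) '' S) then Y t ω
    else if h : ∃ x, (t, x) ∈ closure ((fun s => (s, Y s ω)) '' S) then h.choose else 0
  have himage : ∀ ω, (fun s => (s, Y' s ω)) '' S = (fun s => (s, Y s ω)) '' S := by
    intro ω
    refine image_congr fun s hs => ?_
    have : (s, Y s ω) ∈ closure ((fun s => (s, Y s ω)) '' S) := subset_closure ⟨s, hs, rfl⟩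
    simp only [Y', if_pos this]
  refine ⟨Y', fun t ht => ?_, S, hS0, hS, ?_⟩
  · filter_upwards [h1 t ht] with ω hω
    exact if_pos hω
  · filter_upwards [h2] with ω hω t ht
    rw [himage]
    by_cases h : (t, Y t ω) ∈ closure ((fun s => (s, Y s ω)) '' S)
    · simpa only [Y', if_pos h] using h
    · have hx := hω t ht
      simp only [Y', if_neg h, dif_pos hx]
      exact hx.choose_spec

theorem IsReversedGaussianMartingale.memLp {Y : ℝ≥0 → Ω → ℝ} {w : ℝ≥0 → ℝ}
    (hY : IsReversedGaussianMartingale P Y w) {t : ℝ≥0} (ht : 0 < t) : MemLp (Y t) 2 P :=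
  (hY.gaussian.hasGaussianLaw_eval (⟨t, ht⟩ : Ioi (0 : ℝ≥0))).memLp_two

theorem IsReversedGaussianMartingale.integral_sub_sq {Y : ℝ≥0 → Ω → ℝ} {w : ℝ≥0 → ℝ}
    (hY : IsReversedGaussianMartingale P Y w) {a b : ℝ≥0} (ha : 0 < a) (hab : a ≤ b) :
    ∫ ω, (Y a ω - Y b ω) ^ 2 ∂P = w a - w b := by
  have hb := ha.trans_le hab
  have e : ∀ ω, (Y a ω - Y b ω) ^ 2 = Y a ω * Y a ω - 2 * (Y b ω * Y a ω) + Y b ω * Y b ω :=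
    fun ω => by ring
  have i1 : ∀ x y, 0 < x → 0 < y → Integrable (fun ω => Y x ω * Y y ω) P :=
    fun x y hx hy => (hY.memLp hx).integrable_mul (hY.memLp hy)
  simp only [e]
  rw [integral_add (f := fun ω => Y a ω * Y a ω - 2 * (Y b ω * Y a ω))
      ((i1 a a ha ha).sub ((i1 b a hb ha).const_mul 2)) (i1 b b hb hb),
    integral_sub (i1 a a ha ha) ((i1 b a hb ha).const_mul 2), integral_const_mul,
    hY.cov a a ha le_rfl, hY.cov a b ha hab, hY.cov b b hb le_rfl]
  ring

theorem IsReversedGaussianMartingale.antitoneOn {Y : ℝ≥0 → Ω → ℝ} {w : ℝ≥0 → ℝ}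
    (hY : IsReversedGaussianMartingale P Y w) : AntitoneOn w (Ioi 0) := by
  intro a ha b _ hab
  have h := hY.integral_sub_sq ha hab
  have : 0 ≤ ∫ ω, (Y a ω - Y b ω) ^ 2 ∂P := integral_nonneg fun ω => sq_nonneg _
  linarith

/-- The set `S` is chosen so that `{(s, w s) : s ∈ S}` is dense in the graph of `w`; then every
`Y_t` is a mean square limit of `Y_s`, `s ∈ S`. The paths over `S` are bounded by the maximal
inequality, which provides limit values at all times simultaneously. -/
theorem IsReversedGaussianMartingale.exists_separable_version [IsProbabilityMeasure P]
    {Y : ℝ≥0 → Ω → ℝ} {w : ℝ≥0 → ℝ} (hY : IsReversedGaussianMartingale P Y w) :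
    ∃ Y' : ℝ≥0 → Ω → ℝ, (∀ t, 0 < t → Y' t =ᵐ[P] Y t) ∧ IsSeparableProcess P Y' := by
  have hmem : ∀ t, 0 < t → MemLp (Y t) 2 P := fun t ht => hY.memLp ht
  obtain ⟨c, hcsub, hc, hcl⟩ := (TopologicalSpace.IsSeparable.of_separableSpace
    ((fun t => (t, w t)) '' Ioi (0 : ℝ≥0))).exists_countable_dense_subset
  have hc' : ∀ p ∈ c, 0 < p.1 ∧ p.2 = w p.1 := by
    intro p hp
    obtain ⟨t, ht, rfl⟩ := hcsub hp
    exact ⟨ht, rfl⟩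
  have hS0 : Prod.fst '' c ⊆ Ioi 0 := by
    rintro _ ⟨p, hp, rfl⟩
    exact (hc' p hp).1
  have happrox : ∀ t : ℝ≥0, 0 < t → ∃ s : ℕ → ℝ≥0, (∀ n, s n ∈ Prod.fst '' c) ∧
      Tendsto s atTop (𝓝 t) ∧ Tendsto (fun n => w (s n)) atTop (𝓝 (w t)) := by
    intro t ht
    obtain ⟨p, hp, hlim⟩ := mem_closure_iff_seq_limit.1 (hcl ⟨t, ht, rfl⟩)
    refine ⟨fun n => (p n).1, fun n => ⟨_, hp n, rfl⟩, ?_, ?_⟩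
    · exact (continuous_fst.tendsto _).comp hlim
    · refine ((continuous_snd.tendsto _).comp hlim).congr fun n => ?_
      exact (hc' _ (hp n)).2
  have hS := hc.image Prod.fst
  refine exists_isSeparableProcess hS0 hS (fun t ht => ?_) ?_
  · obtain ⟨s, hs, hst, hsw⟩ := happrox t ht
    have hs0 : ∀ n, 0 < s n := fun n => hS0 (hs n)
    have hdist : ∀ a b, 0 < a → 0 < b → ∫ ω, (Y a ω - Y b ω) ^ 2 ∂P ≤ |w a - w b| := by
      intro a b ha hb
      rcases le_total a b with hab | hab
      · rw [hY.integral_sub_sq ha hab]; exact le_abs_self _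
      · have : ∫ ω, (Y a ω - Y b ω) ^ 2 ∂P = ∫ ω, (Y b ω - Y a ω) ^ 2 ∂P :=
          integral_congr_ae (ae_of_all _ fun ω => by ring)
        rw [this, hY.integral_sub_sq hb hab, abs_sub_comm]
        exact le_abs_self _
    have hL2 : Tendsto (fun n => eLpNorm (Y (s n) - Y t) 2 P) atTop (𝓝 0) := by
      have hsq : Tendsto (fun n => eLpNorm (Y (s n) - Y t) 2 P ^ 2) atTop (𝓝 0) := by
        have hb : Tendsto (fun n => ENNReal.ofReal |w (s n) - w t|) atTop (𝓝 0) := by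
          have := ENNReal.tendsto_ofReal (hsw.sub_const (w t)).abs
          simpa using this
        refine tendsto_of_tendsto_of_tendsto_of_le_of_le tendsto_const_nhds hb
          (fun _ => zero_le) fun n => ?_
        rw [← ofReal_integral_sq_eq_eLpNorm_sq ((hmem _ (hs0 n)).sub (hmem t ht))]
        exact ENNReal.ofReal_le_ofReal (hdist _ _ (hs0 n) ht)
      have h2 := (ENNReal.continuous_rpow_const (y := (1 / 2 : ℝ))).tendsto 0 |>.comp hsq
      rw [ENNReal.zero_rpow_of_pos (by norm_num)] at h2
      refine h2.congr fun n => ?_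
      simp only [Function.comp_apply]
      rw [← ENNReal.rpow_natCast, ← ENNReal.rpow_mul]
      norm_num
    obtain ⟨ns, hns', hns⟩ := (tendstoInMeasure_of_tendsto_eLpNorm (by norm_num)
      (fun n => (hmem _ (hs0 n)).aestronglyMeasurable) (hmem t ht).aestronglyMeasurable
      hL2).exists_seq_tendsto_ae
    filter_upwards [hns] with ω hω
    refine mem_closure_of_tendsto ((hst.comp hns'.tendsto_atTop).prodMk_nhds hω)
      (Eventually.of_forall fun n => ⟨s (ns n), hs _, rfl⟩)
  · filter_upwards [hY.ae_bounded hS] with ω hω t ht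
    obtain ⟨s, hs, hst, -⟩ := happrox t ht
    obtain ⟨C, hC⟩ := hω (t / 2) (half_pos ht)
    obtain ⟨N, hN⟩ := eventually_atTop.1 (hst.eventually (le_mem_nhds (half_lt_self ht)))
    obtain ⟨x, -, φ, hφ, hx⟩ := tendsto_subseq_of_bounded
      (Metric.isBounded_closedBall (x := (0 : ℝ)) (r := C))
      (x := fun n => Y (s (n + N)) ω) fun n => by
        rw [mem_closedBall_zero_iff, Real.norm_eq_abs]
        exact hC _ (hs _) (hN _ (by omega))
    have hsφ : Tendsto (fun n => s (φ n + N)) atTop (𝓝 t) :=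
      hst.comp ((tendsto_add_atTop_nat N).comp hφ.tendsto_atTop)
    exact ⟨x, mem_closure_of_tendsto (hsφ.prodMk_nhds hx)
      (Eventually.of_forall fun n => ⟨s (φ n + N), hs _, rfl⟩)⟩

end Separable

/-! ### The likelihood -/

section Likelihood

/-- A shifted Gaussian measure has an exponential density. -/
theorem gaussianReal_eq_withDensity (ϑ : ℝ) {v : ℝ≥0} (hv : v ≠ 0) :
    gaussianReal (ϑ * v) v = (gaussianReal 0 v).withDensity
      fun x => ENNReal.ofReal (Real.exp (ϑ * x - ϑ ^ 2 * v / 2)) := by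
  have hv' : (v : ℝ) ≠ 0 := by exact_mod_cast hv
  rw [gaussianReal_of_var_ne_zero _ hv, gaussianReal_of_var_ne_zero _ hv,
    ← withDensity_mul _ (measurable_gaussianPDF _ _) (by fun_prop)]
  congr 1
  ext x
  rw [Pi.mul_apply, gaussianPDF, gaussianPDF, ← ENNReal.ofReal_mul (gaussianPDFReal_nonneg _ _ _)]
  congr 1
  simp only [gaussianPDFReal]
  rw [mul_assoc (√(2 * Real.pi * v))⁻¹, ← Real.exp_add]
  congr 2
  field_simp
  ring

variable {P : Measure Ω} {B : ℝ≥0 → Ω → ℝ} {K : ℝ → ℝ} {T : ℝ≥0}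

theorem IsGaussianNoise.measurable_pathOn (hB : IsGaussianNoise P B) (ϑ : ℝ) :
    Measurable (pathOn (observed ϑ B) T) :=
  measurable_pi_lambda _ fun t => (hB.measurable t).const_add _

/-- The Cameron--Martin formula. If `M` is jointly Gaussian with `B` and `E M B_t = t`, then
`B_t = W_t + (t / v) M` with `W` independent of `M`, and adding the drift `ϑ t` amounts to
replacing the Gaussian variable `M` by `M + ϑ v`. -/
theorem lintegral_pathOn_observed [IsProbabilityMeasure P] (hB : IsGaussianNoise P B)
    {M : Ω → ℝ} (hM : Measurable M)
    (hgauss : IsGaussianProcess (Sum.elim B fun _ : Unit => M) P) (hmean : ∫ ω, M ω ∂P = 0)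
    {v : ℝ≥0} (hv : v ≠ 0) (hvar : ∫ ω, M ω * M ω ∂P = v)
    (hcov : ∀ t ≤ T, ∫ ω, M ω * B t ω ∂P = t) (ϑ : ℝ) {φ : (Iic T → ℝ) → ℝ≥0∞}
    (hφ : Measurable φ) :
    ∫⁻ ω, φ (pathOn (observed ϑ B) T ω) ∂P
      = ∫⁻ ω, ENNReal.ofReal (Real.exp (ϑ * M ω - ϑ ^ 2 * v / 2))
          * φ (pathOn (observed 0 B) T ω) ∂P := by
  have hv' : (v : ℝ) ≠ 0 := by exact_mod_cast hv
  have hMg : HasGaussianLaw M P := hgauss.hasGaussianLaw_eval (Sum.inr ())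
  have hM2 : MemLp M 2 P := hMg.memLp_two
  let W : Iic T → Ω → ℝ := fun t ω => B t ω - ((t : ℝ≥0) / v : ℝ) * M ω
  have hWm : ∀ t, Measurable (W t) := fun t => (hB.measurable t).sub (hM.const_mul _)
  have hind : IndepFun (fun ω t => W t ω) M P := by
    have h : IndepFun (fun ω t => W t ω) (fun ω (_ : Unit) => M ω) P := by
      refine IsGaussianProcess.indepFun_of_covariance_eq_zero (X := W) (Y := fun _ : Unit => M) ?_
        (fun t => (hWm t).aemeasurable) (fun _ => hM.aemeasurable) ?_
      · classical
        refine hgauss.of_isGaussianProcess fun s => ?_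
        rcases s with t | s
        · refine ⟨{Sum.inl (t : ℝ≥0), Sum.inr ()},
            ContinuousLinearMap.proj ⟨Sum.inl (t : ℝ≥0), by simp⟩
              - ((t : ℝ≥0) / v : ℝ) • ContinuousLinearMap.proj ⟨Sum.inr (), by simp⟩, fun ω => ?_⟩
          simp [W]
        · exact ⟨{Sum.inr ()}, ContinuousLinearMap.proj ⟨Sum.inr (), by simp⟩, fun ω => by simp⟩
      · intro t _
        rw [covariance_eq_sub (X := W t) ((hB.memLp t).sub (hM2.const_mul _)) hM2, hmean, mul_zero,
          sub_zero]
        have e : ∀ ω, (W t * M) ω = M ω * B t ω - ((t : ℝ≥0) / v : ℝ) * (M ω * M ω) := fun ω => by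
          simp only [W, Pi.mul_apply]; ring
        simp only [e]
        have i1 : Integrable (fun ω => M ω * B t ω) P := hM2.integrable_mul (hB.memLp t)
        have i2 : Integrable (fun ω => M ω * M ω) P := hM2.integrable_mul hM2
        rw [integral_sub i1 (i2.const_mul _),
          integral_const_mul, hvar, hcov t t.2, div_mul_cancel₀ _ hv', sub_self]
    exact h.comp measurable_id (measurable_pi_apply ())
  have hWm' : Measurable (fun ω t => W t ω) := measurable_pi_lambda _ hWm
  have hlaw : P.map M = gaussianReal 0 v := by
    rw [hMg.map_eq_gaussianReal, hmean, variance_eq_sub hM2, hmean]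
    congr 1
    have e : ∀ ω, (M ^ 2) ω = M ω * M ω := fun ω => by simp [sq]
    simp only [e, hvar]
    simp
  have hlaw' : P.map (fun ω => M ω + ϑ * v) = gaussianReal (ϑ * v) v := by
    have h := Measure.map_map (μ := P) (measurable_id.add_const (ϑ * v)) hM
    simp only [id] at h
    rw [hlaw, gaussianReal_map_add_const, zero_add] at h
    exact h.symm
  have hind' : IndepFun (fun ω t => W t ω) (fun ω => M ω + ϑ * v) P :=
    hind.comp measurable_id (measurable_id.add_const _)
  have hpair := (indepFun_iff_map_prod_eq_prod_map_map hWm'.aemeasurable hM.aemeasurable).1 hind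
  have hpair' := (indepFun_iff_map_prod_eq_prod_map_map hWm'.aemeasurable
    (hM.add_const _).aemeasurable).1 hind'
  have hρ' : Measurable fun p : (Iic T → ℝ) × ℝ =>
      ENNReal.ofReal (Real.exp (ϑ * p.2 - ϑ ^ 2 * v / 2)) := by fun_prop
  have hρ : Measurable fun x : ℝ => ENNReal.ofReal (Real.exp (ϑ * x - ϑ ^ 2 * v / 2)) := by fun_prop
  rw [hlaw', gaussianReal_eq_withDensity ϑ hv, prod_withDensity_right hρ, ← hlaw, ← hpair] at hpair'
  -- the path with drift `ϑ` is the same function `F` of `W` and `M + ϑ v` for every `ϑ`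
  let F : (Iic T → ℝ) × ℝ → Iic T → ℝ := fun p t => p.1 t + ((t : ℝ≥0) / v : ℝ) * p.2
  have hF : Measurable F := measurable_pi_lambda _ fun t => by fun_prop
  have e0 : ∀ ω, pathOn (observed 0 B) T ω = F (fun t => W t ω, M ω) := by
    intro ω
    ext t
    simp [pathOn, observed, F, W]
  have eϑ : ∀ ω, pathOn (observed ϑ B) T ω = F (fun t => W t ω, M ω + ϑ * v) := by
    intro ω
    ext t
    simp only [pathOn, observed, F, W]
    field_simp
    ring
  simp only [e0, eϑ]
  have hφF : Measurable fun p => φ (F p) := hφ.comp hF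
  rw [← lintegral_map (f := fun p => φ (F p)) hφF (hWm'.prodMk (hM.add_const _)), hpair',
    lintegral_withDensity_eq_lintegral_mul _ hρ' hφF,
    lintegral_map (hρ'.mul hφF) (hWm'.prodMk hM)]
  rfl

/-- The integral `∫ f dB` is a measurable function of the path on `[0, T]`, and adding a drift
`ϑ t` to the path adds `ϑ ∫ f`. -/
theorem exists_measurable_pathFunctional (hB : IsGaussianNoise P B) (hT : 0 < T) {f : ℝ → ℝ}
    (hf : MemLp f 2 (volume.restrict (Icc (0 : ℝ) T))) {M : Ω → ℝ}
    (hM : IsStochIntegral P B T f M) :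
    ∃ m : (Iic T → ℝ) → ℝ, Measurable m ∧ ∀ ϑ : ℝ, ∀ᵐ ω ∂P,
      m (pathOn (observed ϑ B) T ω) = M ω + ϑ * ∫ u in (0 : ℝ)..T, f u := by
  obtain ⟨g, hg⟩ := Step.exists_tendsto hT hf
  have hgint := tendsto_integral_step hf hg (continuous_const (y := (1 : ℝ)))
  simp only [mul_one] at hgint
  obtain ⟨ns, hns', hns⟩ := (tendstoInMeasure_of_tendsto_eLpNorm (by norm_num)
    (fun n => (hB.memLp_integral (g n)).aestronglyMeasurable) hM.1.aestronglyMeasurable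
    (hM.2 g hg)).exists_seq_tendsto_ae
  let m : ℕ → (Iic T → ℝ) → ℝ := fun n x => ∑ i, (g (ns n)).coeff i *
    (x ⟨(g (ns n)).right i, (g (ns n)).right_le i⟩
      - x ⟨(g (ns n)).left i, ((g (ns n)).left_le_right i).trans ((g (ns n)).right_le i)⟩)
  have hm : ∀ n, Measurable (m n) := fun n => by
    simp only [m]; fun_prop
  -- `limsup` is a measurable choice of the limit, wherever the limit exists
  refine ⟨fun x => limsup (fun n => m n x) atTop, Measurable.limsup hm, fun ϑ => ?_⟩
  filter_upwards [hns] with ω hω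
  have e : ∀ n, m n (pathOn (observed ϑ B) T ω)
      = (g (ns n)).integral B ω + ϑ * ∫ u in (0 : ℝ)..T, (g (ns n)).toFun u := by
    intro n
    rw [add_comm, ← Step.integral_observed]
    rfl
  simp only [e]
  exact (hω.add ((hgint.comp hns'.tendsto_atTop).const_mul ϑ)).limsup_eq

theorem exp_quadratic_lt {m v : ℝ} (hv : 0 < v) {ϑ : ℝ} (hϑ : ϑ ≠ m / v) :
    Real.exp (ϑ * m - ϑ ^ 2 * v / 2) < Real.exp (m / v * m - (m / v) ^ 2 * v / 2) := by
  rw [Real.exp_lt_exp]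
  have h : m / v * m - (m / v) ^ 2 * v / 2 - (ϑ * m - ϑ ^ 2 * v / 2) = v / 2 * (ϑ - m / v) ^ 2 := by
    field_simp
    ring
  have : 0 < v / 2 * (ϑ - m / v) ^ 2 := by
    have := sub_ne_zero.2 hϑ
    positivity
  linarith

/-- Two likelihood functions agree, for all parameters at once, at almost every observed path: they
agree for rational parameters by uniqueness of densities, and for all by continuity. -/
theorem IsLikelihood.ae_eq [IsProbabilityMeasure P] {L L' : ℝ → (Iic T → ℝ) → ℝ}
    (hB : IsGaussianNoise P B)
    (hL : IsLikelihood P B T L) (hL' : IsLikelihood P B T L') (θ : ℝ) :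
    ∀ᵐ ω ∂P, ∀ ϑ, L ϑ (pathOn (observed θ B) T ω) = L' ϑ (pathOn (observed θ B) T ω) := by
  have h1 : ∀ q : ℚ, ∀ᵐ x ∂(P.map (pathOn (observed 0 B) T)), L q x = L' q x := by
    intro q
    have hfin : ∫⁻ x, ENNReal.ofReal (L q x) ∂(P.map (pathOn (observed 0 B) T)) ≠ ∞ := by
      have h := congrArg (fun μ => μ univ) (hL.density q)
      simp only [withDensity_apply _ MeasurableSet.univ, Measure.restrict_univ] at h
      rw [← h]
      have := Measure.isProbabilityMeasure_map (μ := P)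
        (hB.measurable_pathOn (T := T) q).aemeasurable
      exact measure_ne_top _ _
    have h := (withDensity_eq_iff (hL.measurable q).ennreal_ofReal.aemeasurable
      (hL'.measurable q).ennreal_ofReal.aemeasurable hfin).1
      ((hL.density q).symm.trans (hL'.density q))
    filter_upwards [h] with x hx
    exact (ENNReal.ofReal_eq_ofReal_iff (hL.nonneg _ _) (hL'.nonneg _ _)).1 hx
  have h2 : ∀ᵐ x ∂(P.map (pathOn (observed 0 B) T)), ∀ ϑ, L ϑ x = L' ϑ x := by
    filter_upwards [ae_all_iff.2 h1] with x hx ϑ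
    have := Rat.denseRange_cast.equalizer (hL.continuous x) (hL'.continuous x) (funext hx)
    exact congrFun this ϑ
  have hac : P.map (pathOn (observed θ B) T) ≪ P.map (pathOn (observed 0 B) T) := by
    rw [hL.density θ]
    exact withDensity_absolutelyContinuous _ _
  exact ae_of_ae_map (hB.measurable_pathOn θ).aemeasurable (hac.ae_le h2)

/-- The likelihood is `exp (ϑ m - ϑ² v / 2)`, where `m` is the value of `∫ h_T dX` at the observed
path, and it is maximal at `m / v` only. -/
theorem isMLE_of_isStochIntegral [IsProbabilityMeasure P] (hB : IsGaussianNoise P B)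
    (hK : HasCovKernel P B K) (hT : 0 < T)
    {f : ℝ → ℝ} (hf : SolvesOne K T f) (hv : 0 < ∫ u in (0 : ℝ)..T, f u) {θ : ℝ} {I est : Ω → ℝ}
    (hI : IsStochIntegral P (observed θ B) T f I)
    (hest : ∀ᵐ ω ∂P, est ω = I ω / ∫ u in (0 : ℝ)..T, f u) : IsMLE P B θ T est := by
  obtain ⟨M, hMm, hM⟩ := exists_isStochIntegral hB hK hT hf.1
  obtain ⟨m, hm, hmpath⟩ := exists_measurable_pathFunctional hB hT hf.1 hM
  set v : ℝ := ∫ u in (0 : ℝ)..T, f u with hvdef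
  have hv' : v.toNNReal ≠ 0 := by simpa using hv
  have hvc : (v.toNNReal : ℝ) = v := Real.coe_toNNReal _ hv.le
  let Λ : ℝ → (Iic T → ℝ) → ℝ := fun ϑ x => Real.exp (ϑ * m x - ϑ ^ 2 * v / 2)
  have hΛ : IsLikelihood P B T Λ := by
    refine ⟨fun ϑ => by simp only [Λ]; fun_prop, fun ϑ x => (Real.exp_pos _).le,
      fun x => by simp only [Λ]; fun_prop, fun ϑ => ?_⟩
    have hΛm : Measurable fun x => ENNReal.ofReal (Λ ϑ x) := by simp only [Λ]; fun_prop
    refine Measure.ext_of_lintegral _ fun φ hφ => ?_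
    rw [lintegral_map hφ (hB.measurable_pathOn ϑ), lintegral_withDensity_eq_lintegral_mul _ hΛm hφ,
      lintegral_map (hΛm.mul hφ) (hB.measurable_pathOn 0),
      lintegral_pathOn_observed hB hMm (isGaussianProcess_sumElim hB (fun _ : Unit => hT)
        (fun _ => hf.1) (fun _ => hM)) (hM.integral_eq_zero hB hT hf.1) hv'
        (by rw [hvc]; exact hM.integral_mul_of_solvesOne hB hK hT hf hT le_rfl hf.1 hM)
        (fun t ht => hM.integral_mul_noise_of_solvesOne hB hK hT hf ht) ϑ hφ]
    refine lintegral_congr_ae ?_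
    filter_upwards [hmpath 0] with ω hω
    simp only [Pi.mul_apply, Λ, hω, hvc, zero_mul, add_zero]
  refine ⟨⟨Λ, hΛ⟩, fun L hL => ?_⟩
  have hIM := ((isStochIntegral_observed_iff hB hf.1 θ).1 hI).ae_eq hB hT hf.1 hM
  filter_upwards [hL.ae_eq hB hΛ θ, hest, hmpath θ, hIM] with ω h1 h2 h3 h4 ϑ hϑ
  rw [h1, h1]
  have h5 : est ω = m (pathOn (observed θ B) T ω) / v := by
    rw [h2, h3, ← h4, hvdef]
    ring_nf
  rw [h5] at hϑ ⊢
  exact exp_quadratic_lt hv hϑ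

end Likelihood

/-! ### Consistency -/

section Consistency

variable {P : Measure Ω} {B : ℝ≥0 → Ω → ℝ} {K : ℝ → ℝ}

/-- The energy `v = ∫_0^T h_T` is the variance of `M = ∫ h_T dB`; since `E M B_T = T`, the
Cauchy--Schwarz inequality bounds it from below. -/
theorem IsStochIntegral.energy_pos_and_le (hB : IsGaussianNoise P B) (hK : HasCovKernel P B K)
    {T : ℝ≥0} (hT : 0 < T) {f : ℝ → ℝ} (hf : SolvesOne K T f) {M : Ω → ℝ}
    (hM : IsStochIntegral P B T f M) :
    0 < (∫ u in (0 : ℝ)..T, f u) ∧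
      (T : ℝ) ^ 2 / (∫ u in (0 : ℝ)..T, f u) ≤ ∫ ω, B T ω ^ 2 ∂P := by
  have hT' : (0 : ℝ) < T := by exact_mod_cast hT
  set v := ∫ u in (0 : ℝ)..T, f u with hvdef
  have hMM : ∫ ω, M ω * M ω ∂P = v := hM.integral_mul_of_solvesOne hB hK hT hf hT le_rfl hf.1 hM
  have hMB : ∫ ω, M ω * B T ω ∂P = T := hM.integral_mul_noise_of_solvesOne hB hK hT hf le_rfl
  have iMM : Integrable (fun ω => M ω * M ω) P := hM.1.integrable_mul hM.1
  have iMB : Integrable (fun ω => M ω * B T ω) P := hM.1.integrable_mul (hB.memLp T)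
  have iBB : Integrable (fun ω => B T ω ^ 2) P := (hB.memLp T).integrable_sq
  have hquad : ∀ c : ℝ, 0 ≤ ∫ ω, B T ω ^ 2 ∂P - 2 * c * T + c ^ 2 * v := by
    intro c
    have h : 0 ≤ ∫ ω, (B T ω - c * M ω) ^ 2 ∂P := integral_nonneg fun ω => sq_nonneg _
    have e : ∀ ω, (B T ω - c * M ω) ^ 2
        = B T ω ^ 2 - 2 * c * (M ω * B T ω) + c ^ 2 * (M ω * M ω) := fun ω => by ring
    simp only [e] at h
    rwa [integral_add (f := fun ω => B T ω ^ 2 - 2 * c * (M ω * B T ω))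
        (iBB.sub (iMB.const_mul _)) (iMM.const_mul _), integral_sub iBB (iMB.const_mul _),
      integral_const_mul, integral_const_mul, hMM, hMB] at h
  have hv0 : 0 ≤ v := by
    rw [← hMM]; exact integral_nonneg fun ω => mul_self_nonneg _
  have hv : 0 < v := by
    refine hv0.lt_of_ne fun hv => ?_
    rw [← hv] at hquad
    -- if `v = 0`, the affine function of `c` is nonnegative, although its slope is `-2 T < 0`
    have := hquad ((∫ ω, B T ω ^ 2 ∂P + 1) / (2 * T))
    have e : 2 * ((∫ ω, B T ω ^ 2 ∂P + 1) / (2 * T)) * (T : ℝ) = ∫ ω, B T ω ^ 2 ∂P + 1 := by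
      field_simp
    rw [e] at this
    linarith
  refine ⟨hv, ?_⟩
  -- the minimizer of the quadratic
  have h := hquad (T / v)
  have e : 2 * ((T : ℝ) / v) * T - (T / v) ^ 2 * v = T ^ 2 / v := by
    field_simp
    ring
  linarith

/-- The error `M_T / v_T` of the estimator, with `M_T = ∫ h_T dB` and `v_T = ∫_0^T h_T`, is a
reversed Gaussian martingale. -/
theorem isReversedGaussianMartingale_error [IsProbabilityMeasure P] (hB : IsGaussianNoise P B)
    (hK : HasCovKernel P B K)
    {h : ℝ≥0 → ℝ → ℝ} (hh : ∀ T : ℝ≥0, 0 < T → SolvesOne K T (h T)) {M : ℝ≥0 → Ω → ℝ}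
    (hMm : ∀ T, Measurable (M T)) (hM : ∀ T, 0 < T → IsStochIntegral P B T (h T) (M T)) :
    IsReversedGaussianMartingale P (fun T ω => M T ω / ∫ u in (0 : ℝ)..T, h T u)
      (fun T => 1 / ∫ u in (0 : ℝ)..T, h T u) where
  measurable T := (hMm T).div_const _
  gaussian := by
    have h1 := isGaussianProcess_sumElim hB (S := fun T : Ioi (0 : ℝ≥0) => (T : ℝ≥0))
      (f := fun T => h T) (I := fun T => M T) (fun T => T.2) (fun T => (hh T T.2).1)
      (fun T => hM T T.2)
    have h2 := IsGaussianProcess.smul (P := P) (X := fun (T : Ioi (0 : ℝ≥0)) => M T)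
      (fun T : Ioi (0 : ℝ≥0) => (∫ u in (0 : ℝ)..(T : ℝ≥0), h T u)⁻¹) (h1.comp_right Sum.inr)
    have e : (fun (T : Ioi (0 : ℝ≥0)) ω => M T ω / ∫ u in (0 : ℝ)..(T : ℝ≥0), h T u)
        = fun (T : Ioi (0 : ℝ≥0)) ω => (∫ u in (0 : ℝ)..(T : ℝ≥0), h T u)⁻¹ • M T ω := by
      ext T ω
      simp [div_eq_inv_mul]
    rw [e]
    exact h2
  centered T hT := by
    rw [integral_div, (hM T hT).integral_eq_zero hB hT (hh T hT).1, zero_div]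
  cov s t hs hst := by
    have ht := hs.trans_le hst
    have hvs := ((hM s hs).energy_pos_and_le hB hK hs (hh s hs)).1
    have e : ∀ ω, M t ω / (∫ u in (0 : ℝ)..t, h t u) * (M s ω / ∫ u in (0 : ℝ)..s, h s u)
        = M t ω * M s ω / ((∫ u in (0 : ℝ)..t, h t u) * ∫ u in (0 : ℝ)..s, h s u) :=
      fun ω => div_mul_div_comm _ _ _ _
    simp only [e]
    rw [integral_div, (hM t ht).integral_mul_of_solvesOne hB hK ht (hh t ht) hs hst (hh s hs).1
      (hM s hs), div_mul_cancel_right₀ hvs.ne', one_div]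

/-- The inverse energy tends to `0`: it is antitone, and along the integers it is at most
`E B_N² / N²`. -/
theorem tendsto_inv_energy [IsProbabilityMeasure P] (hB : IsGaussianNoise P B)
    (hK : HasCovKernel P B K)
    {h : ℝ≥0 → ℝ → ℝ} (hh : ∀ T : ℝ≥0, 0 < T → SolvesOne K T (h T))
    (hcov : Tendsto (fun N : ℕ => ∫ ω, (B ((N : ℝ≥0) + 1) ω - B (N : ℝ≥0) ω) * B 1 ω ∂P)
      atTop (𝓝 0)) {M : ℝ≥0 → Ω → ℝ}
    (hMm : ∀ T, Measurable (M T)) (hM : ∀ T, 0 < T → IsStochIntegral P B T (h T) (M T)) :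
    Tendsto (fun T : ℝ≥0 => 1 / ∫ u in (0 : ℝ)..T, h T u) atTop (𝓝 0) := by
  have hanti := (isReversedGaussianMartingale_error hB hK hh hMm hM).antitoneOn
  have hpos : ∀ T : ℝ≥0, 0 < T → 0 < 1 / ∫ u in (0 : ℝ)..T, h T u := fun T hT =>
    one_div_pos.2 ((hM T hT).energy_pos_and_le hB hK hT (hh T hT)).1
  have hces := (hcov.abs.cesaro).const_mul 2
  simp only [abs_zero, mul_zero] at hces
  rw [Metric.tendsto_nhds]
  intro ε hε
  obtain ⟨N, hN, hN0⟩ := ((hces.eventually (gt_mem_nhds hε)).and (eventually_gt_atTop 0)).exists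
  have hN' : (0 : ℝ) < N := by exact_mod_cast hN0
  have hNN : (0 : ℝ≥0) < N := by exact_mod_cast hN0
  have hbound : 1 / (∫ u in (0 : ℝ)..(N : ℝ≥0), h N u) < ε := by
    refine lt_of_le_of_lt ?_ hN
    have h1 := ((hM N hNN).energy_pos_and_le hB hK hNN (hh N hNN)).2.trans (hB.integral_sq_le N)
    rw [NNReal.coe_natCast] at h1 ⊢
    set A := ∑ n ∈ Finset.range N, |∫ ω, (B ((n : ℝ≥0) + 1) ω - B (n : ℝ≥0) ω) * B 1 ω ∂P|
    have e1 : 1 / (∫ u in (0 : ℝ)..N, h N u)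
        = (N : ℝ) ^ 2 / (∫ u in (0 : ℝ)..N, h N u) / (N : ℝ) ^ 2 := by
      field_simp
    have e2 : 2 * ((N : ℝ)⁻¹ * A) = 2 * N * A / (N : ℝ) ^ 2 := by
      field_simp
    rw [e1, e2]
    gcongr
  filter_upwards [eventually_ge_atTop (N : ℝ≥0)] with T hT
  have hT0 : 0 < T := hNN.trans_le hT
  rw [Real.dist_eq, sub_zero, abs_of_pos (hpos T hT0)]
  exact (hanti hNN hT0 hT).trans_lt hbound

end Consistency

end DriftMLE

end

/-- Strong consistency of the maximum likelihood estimator of the drift by continuous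
observations. -/
theorem mainTheorem2 {Ω : Type*} [MeasurableSpace Ω] (P : Measure Ω) [IsProbabilityMeasure P]
    (B : ℝ≥0 → Ω → ℝ) (hB : DriftMLE.IsGaussianNoise P B)
    (K : ℝ → ℝ) (hK : DriftMLE.HasCovKernel P B K)
    (h : ℝ≥0 → ℝ → ℝ) (hh : ∀ T : ℝ≥0, 0 < T → DriftMLE.SolvesOne K T (h T))
    (hcov : Tendsto (fun N : ℕ => ∫ ω, (B ((N : ℝ≥0) + 1) ω - B (N : ℝ≥0) ω) * B 1 ω ∂P)
      atTop (𝓝 0))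
    (θ : ℝ) :
    (∃ θhat : ℝ≥0 → Ω → ℝ,
      DriftMLE.IsEstimatorProcess P (DriftMLE.observed θ B) h θhat ∧
        DriftMLE.IsSeparableProcess P θhat) ∧
    ∀ θhat : ℝ≥0 → Ω → ℝ,
      DriftMLE.IsEstimatorProcess P (DriftMLE.observed θ B) h θhat →
      (∀ T : ℝ≥0, 0 < T → DriftMLE.IsMLE P B θ T (θhat T)) ∧
      (∀ D : Set ℝ≥0, D.Countable →
        ∀ᵐ ω ∂P, Tendsto (fun T => θhat T ω) (atTop ⊓ 𝓟 D) (𝓝 θ)) ∧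
      (DriftMLE.IsSeparableProcess P θhat →
        ∀ᵐ ω ∂P, Tendsto (fun T => θhat T ω) atTop (𝓝 θ)) := by
  have hex : ∀ T : ℝ≥0, ∃ I : Ω → ℝ, Measurable I ∧
      (0 < T → DriftMLE.IsStochIntegral P B T (h T) I) := by
    intro T
    by_cases hT : 0 < T
    · obtain ⟨I, hI, hI'⟩ := DriftMLE.exists_isStochIntegral hB hK hT (hh T hT).1
      exact ⟨I, hI, fun _ => hI'⟩
    · exact ⟨0, measurable_zero, fun h => absurd h hT⟩
  choose M hMm hM using hex
  have hY := DriftMLE.isReversedGaussianMartingale_error hB hK hh hMm hM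
  have hw := DriftMLE.tendsto_inv_energy hB hK hh hcov hMm hM
  have hv : ∀ T : ℝ≥0, 0 < T → 0 < ∫ u in (0 : ℝ)..T, h T u := fun T hT =>
    ((hM T hT).energy_pos_and_le hB hK hT (hh T hT)).1
  refine ⟨?_, fun θhat hθ => ?_⟩
  · obtain ⟨Y', hY', hsep⟩ := hY.exists_separable_version
    refine ⟨fun T ω => θ + Y' T ω, fun T hT => ?_, hsep.const_add θ⟩
    refine ⟨fun ω => M T ω + θ * ∫ u in (0 : ℝ)..T, h T u, ?_, ?_⟩
    · rw [DriftMLE.isStochIntegral_observed_iff hB (hh T hT).1]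
      simpa using hM T hT
    · filter_upwards [hY' T hT] with ω hω
      have := (hv T hT).ne'
      rw [hω]
      field_simp
      ring
  · have hcount : ∀ D : Set ℝ≥0, D.Countable →
        ∀ᵐ ω ∂P, Tendsto (fun T => θhat T ω) (atTop ⊓ 𝓟 D) (𝓝 θ) := by
      intro D hD
      have heq : ∀ᵐ ω ∂P, ∀ T ∈ D, 0 < T →
          θhat T ω = θ + M T ω / ∫ u in (0 : ℝ)..T, h T u := by
        refine (ae_ball_iff hD).2 fun T _ => ?_
        by_cases hT : 0 < T
        · obtain ⟨I, hI, hIθ⟩ := hθ T hT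
          have hIM := ((DriftMLE.isStochIntegral_observed_iff hB (hh T hT).1 θ).1 hI).ae_eq hB hT
            (hh T hT).1 (hM T hT)
          filter_upwards [hIθ, hIM] with ω h1 h2 _
          have := (hv T hT).ne'
          rw [h1, ← h2]
          field_simp
          ring
        · exact ae_of_all _ fun ω h => absurd h hT
      filter_upwards [hY.ae_tendsto_zero hw hD, heq] with ω hω hω'
      have hlim := hω.const_add θ
      rw [add_zero] at hlim
      refine hlim.congr' ?_
      rw [EventuallyEq, eventually_inf_principal]
      filter_upwards [eventually_gt_atTop 0] with T hT hTD
      exact (hω' T hTD hT).symm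
    refine ⟨fun T hT => ?_, hcount, fun hsep => hsep.ae_tendsto hcount⟩
    obtain ⟨I, hI, hIθ⟩ := hθ T hT
    exact DriftMLE.isMLE_of_isStochIntegral hB hK hT (hh T hT) (hv T hT) hI hIθ
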